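/- Let $m,k\ge 0$, $n=2(k+m+2)$, let $G=UT(n)$ be the group of real upper unitriangular $n\times n$ matrices and $\mathfrak g=ut(n)$ its Lie algebra of strictly upper triangular matrices. Identify $\mathfrak g^*$ with the strictly lower triangular matrices via $f(x)=\operatorname{tr}(fx)$, let $G$ act on $\mathfrak g^*$ by the coadjoint action $(\mathrm{Ad}^*_g f)(x)=f(g^{-1}xg)$, let $G^f$ be the stabilizer of $f$, and put $\mathrm{Ad}_G(G^f)=\{hyh^{-1}: h\in G,\ y\in G^f\}$. Partition rows and columns into eight consecutive blocks of sizes $(m,1,1,k,k,1,1,m)$ and write the general $g\in G$ as a block matrix $(C_{ij})_{1\le i,j\le 8}$. Let $f\in\mathfrak g^*$ be the matrix with block $\Lambda_1$ at place $(8,1)$, $\Lambda_2$ at $(5,4)$, numbers $\gamma_1$ at $(6,2)$, $\gamma_2$ at $(7,3)$, $\gamma_3$ at $(7,6)$, and all other blocks zero. Here $\Lambda_1$ ($m\times m$) and $\Lambda_2$ ($k\times k$) are real matrices with zeros outside the second diagonal (the one from the lower left to the upper right corner); all second-diagonal entries of $\Lambda_1$ are nonzero, all second-diagonal entries of $\Lambda_2$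 except possibly the one in the upper right corner are nonzero, $\gamma_1,\gamma_2\ne0$, and $\gamma_3\in\mathbb R$ is arbitrary. Let $\Phi=\{(2,3),(4,5),(6,7)\}$. For an entry $c$ of a block $C_{ij}$, $i<j$, let $\Phi(c)$ be the set of $(a,b)\in\Phi$ with $a>i$ and $b<j$; let $\Delta(c)$ be the minor of $g$ formed by the rows of the blocks $a$ and the columns of the blocks $b$, $(a,b)\in\Phi(c)$ (the empty minor is $1$); let $\tilde\Delta(c)$ be the minor obtained by adding the row and the column of $c$; and let $\tilde c=\pm\Delta(c)^{-1}\tilde\Delta(c)$, where $\pm$ is the cofactor sign of the entry $c$ in the minor $\tilde\Delta(c)$. Put $S=S_0\cup S_1\cup S_2$, where 1. $S_0$ is the set of entries above the diagonal of the blocks $C_{11},C_{44},C_{55},C_{88}$; 2. $S_1$ is the set of all $\tilde c$, where $c$ runs through all entries of the blocks $C_{12},C_{14},C_{16},C_{34},C_{36},C_{38},C_{56},C_{58},C_{78}$; 3. $S_2$ consists of the entries of $C_{23}C_{35}+C_{24}C_{45}$ and of $C_{45}C_{57}+C_{46}C_{67}$, and of the function $\gamma_1C_{23}-\gamma_2C_{67}$.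 Let $d(g)=C_{23}\cdot\det C_{45}\cdot C_{67}$, let $\mathbb R'[G]$ be the localization of the algebra $\mathbb R[G]$ of regular (polynomial) functions on $G$ at the powers of $d$, so that $S\subset\mathbb R'[G]$, and let $I'$ be the ideal of $\mathbb R'[G]$ generated by $S$. Let $\mathrm{Ann}\,I'$ be the set of all $g\in G$ with $d(g)\ne0$ at which every element of $I'$ vanishes. Then the closure of $\mathrm{Ann}\,I'$ in $G$ (for the usual topology of the Lie group $G$) coincides with the closure of $\mathrm{Ad}_G(G^f)$ in $G$. -/

import Mathlib

/-! ### The group `UT(n, ℝ)`, its Lie algebra and the coadjoint action -/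

/-- `UT(n, ℝ)`: real upper triangular matrices of size `n` with units on the diagonal. -/
def UT (n : ℕ) : Submonoid (Matrix (Fin n) (Fin n) ℝ) where
  carrier := {g | (∀ i, g i i = 1) ∧ ∀ i j, j < i → g i j = 0}
  one_mem' := ⟨fun i => Matrix.one_apply_eq i, fun _ _ h => Matrix.one_apply_ne (ne_of_gt h)⟩
  mul_mem' := by
    rintro a b ⟨ha, ha'⟩ ⟨hb, hb'⟩
    refine ⟨fun i => ?_, fun i j hij => ?_⟩
    · rw [Matrix.mul_apply, Finset.sum_eq_single i]
      · rw [ha, hb, one_mul]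
      · intro l _ hl
        rcases lt_or_gt_of_ne hl with h | h
        · rw [ha' i l h, zero_mul]
        · rw [hb' l i h, mul_zero]
      · simp
    · rw [Matrix.mul_apply]
      refine Finset.sum_eq_zero fun l _ => ?_
      rcases lt_or_ge l i with h | h
      · rw [ha' i l h, zero_mul]
      · rw [hb' l j (lt_of_lt_of_le hij h), mul_zero]

namespace UT

variable {n : ℕ}

theorem det_eq_one (g : UT n) : (g : Matrix (Fin n) (Fin n) ℝ).det = 1 := by
  rw [Matrix.det_of_isUpperTriangular (fun i j h => g.2.2 i j h)]
  exact Finset.prod_eq_one fun i _ => g.2.1 i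

theorem inv_mem (g : UT n) : (g : Matrix (Fin n) (Fin n) ℝ)⁻¹ ∈ UT n := by
  have hdet : IsUnit (g : Matrix (Fin n) (Fin n) ℝ).det := by rw [det_eq_one]; exact isUnit_one
  have : Invertible (g : Matrix (Fin n) (Fin n) ℝ) :=
    Matrix.invertibleOfIsUnitDet _ hdet
  have hT : Matrix.BlockTriangular (g : Matrix (Fin n) (Fin n) ℝ)⁻¹ id :=
    Matrix.blockTriangular_inv_of_blockTriangular (fun i j h => g.2.2 i j h)
  refine ⟨fun i => ?_, fun i j h => hT h⟩
  have h1 := congrFun (congrFun (Matrix.nonsing_inv_mul _ hdet) i) i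
  rw [Matrix.mul_apply, Finset.sum_eq_single i, g.2.1 i, mul_one, Matrix.one_apply_eq] at h1
  · exact h1
  · intro l _ hl
    rcases lt_or_gt_of_ne hl with h | h
    · rw [hT (show id l < id i from h), zero_mul]
    · rw [g.2.2 l i h, mul_zero]
  · simp

/-- The group structure: matrix multiplication and the matrix inverse. -/
noncomputable instance : Group (UT n) where
  inv g := ⟨(g : Matrix (Fin n) (Fin n) ℝ)⁻¹, inv_mem g⟩
  inv_mul_cancel g := Subtype.ext <| Matrix.nonsing_inv_mul _ <| by
    rw [det_eq_one]; exact isUnit_one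

end UT

/-- The Lie algebra `ut(n, ℝ)` of `UT(n, ℝ)`: upper triangular matrices with zero diagonal. -/
def ut (n : ℕ) : Submodule ℝ (Matrix (Fin n) (Fin n) ℝ) where
  carrier := {x | ∀ i j, j ≤ i → x i j = 0}
  zero_mem' := fun _ _ _ => rfl
  add_mem' := by
    intro a b ha hb i j h
    rw [Matrix.add_apply, ha i j h, hb i j h, add_zero]
  smul_mem' := by
    intro c a ha i j h
    rw [Matrix.smul_apply, ha i j h, smul_zero]

theorem ut_mul_left {n : ℕ} (g : UT n) {x : Matrix (Fin n) (Fin n) ℝ} (hx : x ∈ ut n) :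
    (g : Matrix (Fin n) (Fin n) ℝ) * x ∈ ut n := by
  intro i j hij
  rw [Matrix.mul_apply]
  refine Finset.sum_eq_zero fun l _ => ?_
  rcases lt_or_ge l i with h | h
  · rw [g.2.2 i l h, zero_mul]
  · rw [hx l j (hij.trans h), mul_zero]

theorem ut_mul_right {n : ℕ} (g : UT n) {x : Matrix (Fin n) (Fin n) ℝ} (hx : x ∈ ut n) :
    x * (g : Matrix (Fin n) (Fin n) ℝ) ∈ ut n := by
  intro i j hij
  rw [Matrix.mul_apply]
  refine Finset.sum_eq_zero fun l _ => ?_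
  rcases le_or_gt l i with h | h
  · rw [hx i l h, zero_mul]
  · rw [g.2.2 l j (lt_of_le_of_lt hij h), mul_zero]

/-- The adjoint action `x ↦ g x g⁻¹` of `UT(n)` on `ut(n)`. -/
noncomputable def adj {n : ℕ} (g : UT n) : ut n →ₗ[ℝ] ut n where
  toFun x := ⟨(g : Matrix (Fin n) (Fin n) ℝ) * x * ((g⁻¹ : UT n) : Matrix (Fin n) (Fin n) ℝ),
    ut_mul_right _ (ut_mul_left g x.2)⟩
  map_add' x y := Subtype.ext <| by simp [mul_add, add_mul]
  map_smul' c x := Subtype.ext <| by simp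

/-- The coadjoint action `(Ad*_g f)(x) = f (g⁻¹ x g)` of `UT(n)` on the dual of `ut(n)`. -/
noncomputable def coadj {n : ℕ} (g : UT n) (f : Module.Dual ℝ (ut n)) : Module.Dual ℝ (ut n) :=
  f.comp (adj g⁻¹)

/-- The stabilizer `G^f` of `f` under the coadjoint action. -/
def coadjStabilizer {n : ℕ} (f : Module.Dual ℝ (ut n)) : Set (UT n) :=
  {g | coadj g f = f}

/-- The union `Ad_G(A)` of all conjugates of the elements of `A`. -/
def conjugates {n : ℕ} (A : Set (UT n)) : Set (UT n) :=
  {x | ∃ h : UT n, ∃ y ∈ A, x = h * y * h⁻¹}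

/-- The linear functional `x ↦ tr (F x)` on `ut(n)` given by a matrix `F`. -/
noncomputable def traceDual {n : ℕ} (F : Matrix (Fin n) (Fin n) ℝ) : Module.Dual ℝ (ut n) :=
  ((Matrix.traceLinearMap (Fin n) ℝ ℝ).comp (LinearMap.mulLeft ℝ F)).comp (ut n).subtype

/-! ### Block partition -/

/-- The sizes `(m, 1, 1, k, k, 1, 1, m)` of the eight blocks. Blocks are numbered `0, …, 7` here:
block number `b` is the `(b+1)`-st block. -/
def blockSize (m k : ℕ) : Fin 8 → ℕ := ![m, 1, 1, k, k, 1, 1, m]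

/-- The number of rows lying before a block. -/
def blockStart (m k : ℕ) : Fin 8 → ℕ :=
  ![0, m, m + 1, m + 2, m + 2 + k, m + 2 + 2 * k, m + 3 + 2 * k, m + 4 + 2 * k]

/-- The matrix size `n = 2(k + m + 2)`. -/
abbrev matSize (m k : ℕ) : ℕ := 2 * (k + m + 2)

theorem blockStart_add_blockSize_le (m k : ℕ) (b : Fin 8) :
    blockStart m k b + blockSize m k b ≤ matSize m k := by
  fin_cases b <;> simp [blockStart, blockSize, matSize] <;> omega

/-- The row (or column) of the whole matrix that is number `i` in block `b`. -/
def pos (m k : ℕ) (b : Fin 8) (i : Fin (blockSize m k b)) : Fin (matSize m k) :=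
  ⟨blockStart m k b + i, lt_of_lt_of_le (Nat.add_lt_add_left i.2 _)
    (blockStart_add_blockSize_le m k b)⟩

theorem pos_lt_pos {m k : ℕ} {a b : Fin 8} (h : a < b) (i : Fin (blockSize m k a)) (j : Fin (blockSize m k b)) :
    pos m k a i < pos m k b j := by
  have key : blockStart m k a + blockSize m k a ≤ blockStart m k b := by
    revert h; clear i j
    fin_cases a <;> fin_cases b <;> simp [blockStart, blockSize] <;> omega
  have := i.2
  simp only [pos, Fin.mk_lt_mk]; omega

/-! ### The functional `f` -/

/-- The `s × s` matrix whose second diagonal is `l₁, …, l_s`, read from the lower left corner to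
the upper right one (`l₁ = l 0` lies in the first column, `l_s` in the last one), and whose other
entries are zero. -/
def antidiag {s : ℕ} (l : Fin s → ℝ) : Matrix (Fin s) (Fin s) ℝ :=
  Matrix.of fun i j => if (i : ℕ) + j + 1 = s then l j else 0

/-- The block matrix with the given blocks. -/
def ofBlocks (m k : ℕ) (M : ∀ a b : Fin 8, Matrix (Fin (blockSize m k a)) (Fin (blockSize m k b)) ℝ) :
    Matrix (Fin (matSize m k)) (Fin (matSize m k)) ℝ :=
  Matrix.of fun p q => ∑ a, ∑ b, ∑ i, ∑ j,
    if pos m k a i = p ∧ pos m k b j = q then M a b i j else 0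

/-- The lower triangular matrix with blocks `Λ₁` at place `(8,1)`, `Λ₂` at `(5,4)`, `γ₁` at `(6,2)`,
`γ₂` at `(7,3)`, `γ₃` at `(7,6)` (places counted from one) and all other blocks zero; here `Λ₁` and
`Λ₂` have the second diagonals `l₁` and `l₂`. -/
def fMatrix (m k : ℕ) (l₁ : Fin m → ℝ) (l₂ : Fin k → ℝ) (γ₁ γ₂ γ₃ : ℝ) :
    Matrix (Fin (matSize m k)) (Fin (matSize m k)) ℝ :=
  ofBlocks m k fun a b =>
    match a, b with
    | 7, 0 => antidiag l₁
    | 4, 3 => antidiag l₂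
    | 5, 1 => Matrix.of fun _ _ => γ₁
    | 6, 2 => Matrix.of fun _ _ => γ₂
    | 6, 5 => Matrix.of fun _ _ => γ₃
    | _, _ => 0

/-! ### Regular functions, the localization and the ideal -/

/-- The algebra `ℝ[UT(n)]` of regular functions: polynomials in the entries above the diagonal. -/
abbrev CoordRing (n : ℕ) : Type := MvPolynomial {p : Fin n × Fin n // p.1 < p.2} ℝ

/-- The value of a regular function at `g`. -/
noncomputable def evalAt {n : ℕ} (g : UT n) : CoordRing n →+* ℝ :=
  MvPolynomial.eval fun p => (g : Matrix (Fin n) (Fin n) ℝ) p.1.1 p.1.2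

/-- The general element of `UT(n)`, as a matrix of regular functions. -/
noncomputable def genMatrix (n : ℕ) : Matrix (Fin n) (Fin n) (CoordRing n) :=
  Matrix.of fun i j => if h : i < j then MvPolynomial.X ⟨(i, j), h⟩ else if i = j then 1 else 0

/-- The blocks `C_{ab}` of the general element. -/
noncomputable def blockC (m k : ℕ) (a b : Fin 8) :
    Matrix (Fin (blockSize m k a)) (Fin (blockSize m k b)) (CoordRing (matSize m k)) :=
  (genMatrix (matSize m k)).submatrix (pos m k a) (pos m k b)

/-- `det C₂₃`, that is the only entry of the `1 × 1` block `C₂₃`. -/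
noncomputable def det23 (m k : ℕ) : CoordRing (matSize m k) :=
  Matrix.det (n := Fin 1) (blockC m k 1 2)

/-- `det C₄₅`. -/
noncomputable def det45 (m k : ℕ) : CoordRing (matSize m k) :=
  Matrix.det (n := Fin k) (blockC m k 3 4)

/-- `det C₆₇`, that is the only entry of the `1 × 1` block `C₆₇`. -/
noncomputable def det67 (m k : ℕ) : CoordRing (matSize m k) :=
  Matrix.det (n := Fin 1) (blockC m k 5 6)

/-- The denominator `d = det C₂₃ · det C₄₅ · det C₆₇`. -/
noncomputable def denom (m k : ℕ) : CoordRing (matSize m k) :=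
  det23 m k * det45 m k * det67 m k

/-- The localization of `ℝ[UT(n)]` at the powers of `d`. -/
abbrev LocRing (m k : ℕ) : Type := Localization.Away (denom m k)

/-- The value of an element of the localization at a point `g` with `d(g) ≠ 0`. -/
noncomputable def evalLoc (m k : ℕ) (g : UT (matSize m k)) (hg : evalAt g (denom m k) ≠ 0) :
    LocRing m k →+* ℝ :=
  IsLocalization.Away.lift (denom m k) (isUnit_iff_ne_zero.mpr hg)

/-- The zero set of an ideal of the localization: the points `g` of `UT(n)` with `d(g) ≠ 0` at
which all elements of the ideal vanish. -/
def zeroSet (m k : ℕ) (I : Ideal (LocRing m k)) : Set (UT (matSize m k)) :=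
  {g | ∃ hg : evalAt g (denom m k) ≠ 0, ∀ φ ∈ I, evalLoc m k g hg φ = 0}

/-- `Φ = {(2,3), (4,5), (6,7)}` (blocks counted from one). -/
def Phi : Finset (Fin 8 × Fin 8) := {(1, 2), (3, 4), (5, 6)}

theorem blockSize_of_mem_Phi (m k : ℕ) {p : Fin 8 × Fin 8} (hp : p ∈ Phi) :
    blockSize m k p.1 = blockSize m k p.2 := by
  simp only [Phi, Finset.mem_insert, Finset.mem_singleton] at hp
  rcases hp with rfl | rfl | rfl <;> rfl

/-- Index set of the rows, and of the columns, of the minor `Δ(c)` of an entry `c` of the block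
`C_{ab}`: the rows of the blocks `p` and the columns of the blocks `q`, for all `(p, q) ∈ Φ` with
`p > a` and `q < b`. -/
abbrev MinorIndex (m k : ℕ) (a b : Fin 8) : Type :=
  Σ p : {p : Fin 8 × Fin 8 // p ∈ Phi ∧ a < p.1 ∧ p.2 < b}, Fin (blockSize m k p.1.1)

/-- The rows of `Δ(c)`. -/
def minorRow (m k : ℕ) (a b : Fin 8) (x : MinorIndex m k a b) : Fin (matSize m k) :=
  pos m k x.1.1.1 x.2

/-- The columns of `Δ(c)`. -/
def minorCol (m k : ℕ) (a b : Fin 8) (x : MinorIndex m k a b) : Fin (matSize m k) :=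
  pos m k x.1.1.2 (Fin.cast (blockSize_of_mem_Phi m k x.1.2.1) x.2)

/-- The minor `Δ(c)` of an entry `c` of the block `C_{ab}`. -/
noncomputable def Delta (m k : ℕ) (a b : Fin 8) : CoordRing (matSize m k) :=
  ((genMatrix (matSize m k)).submatrix (minorRow m k a b) (minorCol m k a b)).det

theorem isUnit_denom (m k : ℕ) : IsUnit (algebraMap (CoordRing (matSize m k)) (LocRing m k) (denom m k)) :=
  IsLocalization.Away.algebraMap_isUnit (denom m k)

theorem gen_lower {n : ℕ} {i j : Fin n} (h : j < i) : genMatrix n i j = 0 := by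
  simp [genMatrix, not_lt.mpr h.le, h.ne']

/-- The determinant of the block `C_p`, for `p ∈ Φ`. -/
noncomputable def bdet (m k : ℕ) (p : {p : Fin 8 × Fin 8 // p ∈ Phi}) : CoordRing (matSize m k) :=
  Matrix.det (Matrix.of fun i j : Fin (blockSize m k p.1.1) => genMatrix (matSize m k) (pos m k p.1.1 i) (pos m k p.1.2 (Fin.cast (blockSize_of_mem_Phi m k p.2) j)))

theorem bdet_dvd (m k : ℕ) (p : {p : Fin 8 × Fin 8 // p ∈ Phi}) : bdet m k p ∣ denom m k := by
  obtain ⟨p, hp⟩ := p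
  have hp' := hp
  simp only [Phi, Finset.mem_insert, Finset.mem_singleton] at hp'
  rcases hp' with rfl | rfl | rfl
  · exact Dvd.intro _ (mul_assoc _ _ _).symm
  · exact Dvd.dvd.mul_right (Dvd.intro_left (det23 m k) rfl) _
  · exact Dvd.intro_left (det23 m k * det45 m k) rfl

/-- `Δ(c)` is a unit in the localization. -/
theorem Delta_isUnit (m k : ℕ) (a b : Fin 8) : IsUnit (algebraMap (CoordRing (matSize m k)) (LocRing m k) (Delta m k a b)) := by
  have A : ∀ p ∈ Phi, ∀ q ∈ Phi, q.1 < p.1 → q.2 < p.1 := by decide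
  have B : ∀ p ∈ Phi, ∀ q ∈ Phi, q.1 = p.1 → q = p := by decide
  have hT : Matrix.BlockTriangular ((genMatrix (matSize m k)).submatrix (minorRow m k a b) (minorCol m k a b)) (fun x => x.1.1.1) := by
    rintro ⟨⟨p, hp, hp'⟩, i⟩ ⟨⟨q, hq, hq'⟩, j⟩ h
    apply gen_lower
    apply pos_lt_pos
    exact A p hp q hq h
  rw [Delta, hT.det_fintype, map_prod]
  rw [IsUnit.prod_univ_iff]
  intro c
  by_cases hc : ∃ p : {p : Fin 8 × Fin 8 // p ∈ Phi ∧ a < p.1 ∧ p.2 < b}, p.1.1 = c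
  · obtain ⟨p, rfl⟩ := hc
    have inj : ∀ q : {p : Fin 8 × Fin 8 // p ∈ Phi ∧ a < p.1 ∧ p.2 < b}, q.1.1 = p.1.1 → q = p := by
      intro q h
      apply Subtype.ext
      exact B p.1 p.2.1 q.1 q.2.1 h
    let f : Fin (blockSize m k p.1.1) → {x : MinorIndex m k a b // x.1.1.1 = p.1.1} := fun i => ⟨⟨p, i⟩, rfl⟩
    have hf : Function.Bijective f := by
      constructor
      · intro i j h; simpa [f] using h
      · rintro ⟨⟨q, i⟩, h⟩
        obtain rfl := inj q h
        exact ⟨i, rfl⟩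
    rw [← Matrix.det_submatrix_equiv_self (Equiv.ofBijective f hf)]
    exact isUnit_of_dvd_unit (map_dvd _ (bdet_dvd m k ⟨p.1, p.2.1⟩)) (isUnit_denom m k)
  · have : IsEmpty {x : MinorIndex m k a b // x.1.1.1 = c} := ⟨fun x => hc ⟨x.1.1, x.2⟩⟩
    rw [Matrix.det_isEmpty]; simp

/-- The signed bordered minor `± Δ̃(c)` of the entry `c` of `C_{ab}` at place `(i, j)`: the row and
the column of `c` are added to those of `Δ(c)`. The added row and the added column are both listed
first (index `none`), so that `c` stands in the upper left corner; listing them in their natural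
order instead multiplies the determinant by the sign of the entry `c` in the minor, so this
determinant is `Δ̃(c)` already multiplied by that sign. -/
noncomputable def signedDeltaTilde (m k : ℕ) (a b : Fin 8) (i : Fin (blockSize m k a))
    (j : Fin (blockSize m k b)) : CoordRing (matSize m k) :=
  ((genMatrix (matSize m k)).submatrix
    (fun x : Option (MinorIndex m k a b) => x.elim (pos m k a i) (minorRow m k a b))
    (fun x : Option (MinorIndex m k a b) => x.elim (pos m k b j) (minorCol m k a b))).det

/-- The rational function `c̃ = ± Δ(c)⁻¹ Δ̃(c)` of the entry `c` of `C_{ab}` at place `(i, j)`. The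
minor `Δ(c)` is a product of some of `det C₂₃`, `det C₄₅`, `det C₆₇`, hence a unit in the
localization (`Delta_isUnit`), and `Ring.inverse` is its inverse. -/
noncomputable def cTilde (m k : ℕ) (a b : Fin 8) (i : Fin (blockSize m k a))
    (j : Fin (blockSize m k b)) : LocRing m k :=
  Ring.inverse (algebraMap (CoordRing (matSize m k)) (LocRing m k) (Delta m k a b)) *
    algebraMap (CoordRing (matSize m k)) (LocRing m k) (signedDeltaTilde m k a b i j)

/-- The blocks `(1,2), (1,4), (1,6), (3,4), (3,6), (3,8), (5,6), (5,8), (7,8)` (counted from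
one). -/
def bulletBlocks : Finset (Fin 8 × Fin 8) :=
  {(0, 1), (0, 3), (0, 5), (2, 3), (2, 5), (2, 7), (4, 5), (4, 7), (6, 7)}

/-- `S₀`: the entries above the diagonal of the blocks `C₁₁, C₄₄, C₅₅, C₈₈`. -/
def S0 (m k : ℕ) : Set (LocRing m k) :=
  {φ | ∃ b ∈ ({0, 3, 4, 7} : Finset (Fin 8)), ∃ i j : Fin (blockSize m k b), i < j ∧
    φ = algebraMap (CoordRing (matSize m k)) (LocRing m k) (blockC m k b b i j)}

/-- `S₁`: the functions `c̃`, for all entries `c` of the distinguished blocks. -/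
def S1 (m k : ℕ) : Set (LocRing m k) :=
  {φ | ∃ p ∈ bulletBlocks, ∃ (i : Fin (blockSize m k p.1)) (j : Fin (blockSize m k p.2)),
    φ = cTilde m k p.1 p.2 i j}

/-- `S₂`: the entries of `C₂₃ C₃₅ + C₂₄ C₄₅` and of `C₄₅ C₅₇ + C₄₆ C₆₇`, and the function
`γ₁ C₂₃ - γ₂ C₆₇`. -/
def S2 (m k : ℕ) (γ₁ γ₂ : ℝ) : Set (LocRing m k) :=
  {φ | ∃ i j, φ = algebraMap (CoordRing (matSize m k)) (LocRing m k)
      ((blockC m k 1 2 * blockC m k 2 4 + blockC m k 1 3 * blockC m k 3 4) i j)} ∪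
  {φ | ∃ i j, φ = algebraMap (CoordRing (matSize m k)) (LocRing m k)
      ((blockC m k 3 4 * blockC m k 4 6 + blockC m k 3 5 * blockC m k 5 6) i j)} ∪
  {algebraMap (CoordRing (matSize m k)) (LocRing m k)
      (MvPolynomial.C γ₁ * det23 m k - MvPolynomial.C γ₂ * det67 m k)}

/-- The ideal `I'` of the localization generated by `S = S₀ ∪ S₁ ∪ S₂`. -/
noncomputable def idealI' (m k : ℕ) (γ₁ γ₂ : ℝ) : Ideal (LocRing m k) :=
  Ideal.span (S0 m k ∪ S1 m k ∪ S2 m k γ₁ γ₂)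

/-! Block places in these comments are counted from one, as in `C_{ij}`; `F` is the matrix of the
functional.

An element `g` fixes the functional exactly when `gF - Fg` has no entries below the diagonal. Solved
block by block (`eq_stabElement`, `stabElement_mem`), this says that the stabilizer consists of the
matrices `normalForm` with arbitrary numbers at (2,6), (2,7), (3,7), with `α` at (2,3) and `γ₁α/γ₂`
at (6,7), and with antidiagonal blocks `B` at (4,5) and `D` at (1,8).

On the side of the ideal, where `d ≠ 0` the function `c̃` is the Schur complement of the entry `c`:
what remains of `c` after the rows of `Δ(c)` have been used to clear the columns of `Δ(c)` in the
row of `c`. The coefficients of such operations are collected in one group element `H`, and the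
equations of `S` say just enough for `H g H⁻¹` to be a normal form, now with `D` arbitrary and `B`
any invertible block (`exists_conj_normalForm`). The first two families in `S₂` reconcile the values
of a coefficient demanded by two different places of the matrix; the last function of `S₂` is the
relation between the blocks (2,3) and (6,7).

Conversely, let `1 + M` be a normal form with nonzero blocks at (2,3) and (6,7), `det B ≠ 0` and the
right relation. All its conjugates lie in the zero set (`conj_normalForm_mem_zeroSet`): the bordered
minors of `h M h⁻¹` vanish because they factor through too small a space, and the two matrix
expressions in `S₂` are blocks of `h M² h⁻¹`.

Two discrepancies remain, and both disappear in the closure. A general `B` or `D` is a limit of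
products `U A V` with `U`, `V` unitriangular and `A` antidiagonal (`dense_bigCell`), and the factors
`U`, `V` are absorbed by a block diagonal conjugation (`conj_normalForm_eq`). Stabilizer elements
with `d = 0` are limits of stabilizer elements whose `α` and antidiagonal entries of `B` are
nonzero. -/

/-! ### Block calculus -/

section Blocks

variable {m k : ℕ}

/-- The block at place `(a, b)` of a matrix. -/
def blk (a b : Fin 8) (P : Matrix (Fin (matSize m k)) (Fin (matSize m k)) ℝ) :
    Matrix (Fin (blockSize m k a)) (Fin (blockSize m k b)) ℝ :=
  P.submatrix (pos m k a) (pos m k b)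

theorem forall_fin_eight {p : Fin 8 → Prop} (h0 : p 0) (h1 : p 1) (h2 : p 2) (h3 : p 3) (h4 : p 4)
    (h5 : p 5) (h6 : p 6) (h7 : p 7) : ∀ a, p a := by
  intro a
  fin_cases a <;> assumption

theorem pos_sigma_bijective (m k : ℕ) :
    Function.Bijective (fun x : Σ b : Fin 8, Fin (blockSize m k b) => pos m k x.1 x.2) := by
  rw [Fintype.bijective_iff_injective_and_card]
  constructor
  · rintro ⟨a, i⟩ ⟨b, j⟩ h
    rcases lt_trichotomy a b with hab | rfl | hab
    · exact absurd h (pos_lt_pos hab i j).ne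
    · have := congrArg Fin.val h
      simp only [pos, Nat.add_left_cancel_iff] at this
      rw [Fin.ext this]
    · exact absurd h (pos_lt_pos hab j i).ne'
  · simp only [Fintype.card_sigma, Fintype.card_fin, Fin.sum_univ_eight]
    simp [blockSize, matSize]
    ring

/-- The row indices, sorted by blocks. -/
noncomputable def posEquiv (m k : ℕ) :
    (Σ b : Fin 8, Fin (blockSize m k b)) ≃ Fin (matSize m k) :=
  Equiv.ofBijective _ (pos_sigma_bijective m k)

theorem exists_pos (u : Fin (matSize m k)) : ∃ a i, pos m k a i = u := by
  obtain ⟨⟨a, i⟩, h⟩ := (pos_sigma_bijective m k).2 u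
  exact ⟨a, i, h⟩

theorem pos_inj {a : Fin 8} {i j : Fin (blockSize m k a)} : pos m k a i = pos m k a j ↔ i = j := by
  simp [pos, Fin.ext_iff]

theorem pos_lt_iff {a : Fin 8} {i j : Fin (blockSize m k a)} :
    pos m k a i < pos m k a j ↔ i < j := by
  simp [pos]

theorem pos_ne {a b : Fin 8} (h : a ≠ b) (i : Fin (blockSize m k a)) (j : Fin (blockSize m k b)) :
    pos m k a i ≠ pos m k b j := by
  rcases lt_or_gt_of_ne h with h | h
  · exact (pos_lt_pos h i j).ne
  · exact (pos_lt_pos h j i).ne'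

theorem sum_pos (f : Fin (matSize m k) → ℝ) : ∑ u, f u = ∑ a, ∑ i, f (pos m k a i) := by
  rw [← (posEquiv m k).sum_comp, Fintype.sum_sigma]
  rfl

theorem blk_ext {P Q : Matrix (Fin (matSize m k)) (Fin (matSize m k)) ℝ}
    (h : ∀ a b, blk a b P = blk a b Q) : P = Q := by
  ext u v
  obtain ⟨a, i, rfl⟩ := exists_pos u
  obtain ⟨b, j, rfl⟩ := exists_pos v
  exact congrFun (congrFun (h a b) i) j

theorem blk_mul (a b : Fin 8) (P Q : Matrix (Fin (matSize m k)) (Fin (matSize m k)) ℝ) :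
    blk a b (P * Q) = ∑ c, blk a c P * blk c b Q := by
  ext i j
  simp only [blk, Matrix.submatrix_apply, Matrix.mul_apply, Matrix.sum_apply]
  exact sum_pos _

theorem blk_add (a b : Fin 8) (P Q : Matrix (Fin (matSize m k)) (Fin (matSize m k)) ℝ) :
    blk a b (P + Q) = blk a b P + blk a b Q := rfl

theorem blk_sub (a b : Fin 8) (P Q : Matrix (Fin (matSize m k)) (Fin (matSize m k)) ℝ) :
    blk a b (P - Q) = blk a b P - blk a b Q := rfl

theorem blk_one_self (a : Fin 8) :
    blk a a (1 : Matrix (Fin (matSize m k)) (Fin (matSize m k)) ℝ) = 1 := by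
  ext i j
  simp [blk, Matrix.one_apply, pos_inj]

theorem blk_one_ne {a b : Fin 8} (h : a ≠ b) :
    blk a b (1 : Matrix (Fin (matSize m k)) (Fin (matSize m k)) ℝ) = 0 := by
  ext i j
  simp [blk, pos_ne h]

theorem blk_ofBlocks (a b : Fin 8)
    (M : ∀ a b : Fin 8, Matrix (Fin (blockSize m k a)) (Fin (blockSize m k b)) ℝ) :
    blk a b (ofBlocks m k M) = M a b := by
  ext i j
  simp only [blk, ofBlocks, Matrix.submatrix_apply, Matrix.of_apply]
  rw [Finset.sum_eq_single a, Finset.sum_eq_single b, Finset.sum_eq_single i,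
    Finset.sum_eq_single j]
  · simp
  · intro j' _ h; simp [pos_inj, h]
  · simp
  · intro i' _ h; simp [pos_inj, h]
  · simp
  · intro b' _ h; simp [pos_ne h]
  · simp
  · intro a' _ h; simp [pos_ne h]
  · simp

theorem mem_UT_of_blk {P : Matrix (Fin (matSize m k)) (Fin (matSize m k)) ℝ}
    (hd : ∀ a, blk a a P ∈ UT (blockSize m k a)) (hl : ∀ a b, b < a → blk a b P = 0) :
    P ∈ UT (matSize m k) := by
  constructor
  · intro u
    obtain ⟨a, i, rfl⟩ := exists_pos u
    exact (hd a).1 i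
  · intro u v h
    obtain ⟨a, i, rfl⟩ := exists_pos u
    obtain ⟨b, j, rfl⟩ := exists_pos v
    rcases lt_trichotomy a b with hab | rfl | hab
    · exact absurd h (pos_lt_pos hab i j).not_gt
    · exact (hd a).2 i j (pos_lt_iff.1 h)
    · exact congrFun (congrFun (hl a b hab) i) j

theorem blk_self_mem_UT (g : UT (matSize m k)) (a : Fin 8) :
    blk a a (g : Matrix (Fin (matSize m k)) (Fin (matSize m k)) ℝ) ∈ UT (blockSize m k a) :=
  ⟨fun _ => g.2.1 _, fun _ _ h => g.2.2 _ _ (pos_lt_iff.2 h)⟩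

theorem blk_lower (g : UT (matSize m k)) {a b : Fin 8} (h : b < a) :
    blk a b (g : Matrix (Fin (matSize m k)) (Fin (matSize m k)) ℝ) = 0 := by
  ext i j
  exact g.2.2 _ _ (pos_lt_pos h j i)

theorem eq_one_of_mem_UT_of_eq_one {s : ℕ} (hs : s = 1) {P : Matrix (Fin s) (Fin s) ℝ}
    (h : P ∈ UT s) : P = 1 := by
  subst hs
  ext i j
  rw [Subsingleton.elim j i, h.1 i, Matrix.one_apply_eq]

/-- The diagonal blocks of size one are `1`. -/
theorem blk_unit_size (g : UT (matSize m k)) {a : Fin 8} (h : a = 1 ∨ a = 2 ∨ a = 5 ∨ a = 6) :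
    blk a a (g : Matrix (Fin (matSize m k)) (Fin (matSize m k)) ℝ) = 1 := by
  refine eq_one_of_mem_UT_of_eq_one ?_ (blk_self_mem_UT g a)
  rcases h with rfl | rfl | rfl | rfl <;> rfl

/-- The family of blocks of the matrix
with blocks `1` on the diagonal, the blocks `A`, `C`, `B`, `P`, `Q`, `R`, `D` at the places
`(2,3)`, `(6,7)`, `(4,5)`, `(2,6)`, `(2,7)`, `(3,7)`, `(1,8)` and zero blocks elsewhere. -/
def normalBlocks (A : Matrix (Fin (blockSize m k 1)) (Fin (blockSize m k 2)) ℝ)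
    (C : Matrix (Fin (blockSize m k 5)) (Fin (blockSize m k 6)) ℝ)
    (P : Matrix (Fin (blockSize m k 1)) (Fin (blockSize m k 5)) ℝ)
    (Q : Matrix (Fin (blockSize m k 1)) (Fin (blockSize m k 6)) ℝ)
    (R : Matrix (Fin (blockSize m k 2)) (Fin (blockSize m k 6)) ℝ)
    (B : Matrix (Fin (blockSize m k 3)) (Fin (blockSize m k 4)) ℝ)
    (D : Matrix (Fin (blockSize m k 0)) (Fin (blockSize m k 7)) ℝ) (a b : Fin 8) :
    Matrix (Fin (blockSize m k a)) (Fin (blockSize m k b)) ℝ :=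
  match a, b with
  | 1, 2 => A
  | 5, 6 => C
  | 1, 5 => P
  | 1, 6 => Q
  | 2, 6 => R
  | 3, 4 => B
  | 0, 7 => D
  | 0, 0 => 1
  | 1, 1 => 1
  | 2, 2 => 1
  | 3, 3 => 1
  | 4, 4 => 1
  | 5, 5 => 1
  | 6, 6 => 1
  | 7, 7 => 1
  | _, _ => 0

theorem normalBlocks_self (A : Matrix (Fin (blockSize m k 1)) (Fin (blockSize m k 2)) ℝ)
    (C P Q R B D) (a : Fin 8) : normalBlocks A C P Q R B D a a = 1 := by
  revert a
  apply forall_fin_eight <;> rfl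

theorem normalBlocks_lower (A : Matrix (Fin (blockSize m k 1)) (Fin (blockSize m k 2)) ℝ)
    (C P Q R B D) (a b : Fin 8) (h : b < a) : normalBlocks A C P Q R B D a b = 0 := by
  revert b
  revert a
  apply forall_fin_eight <;> apply forall_fin_eight <;> intro h <;>
    first
    | exact absurd h (by decide)
    | rfl

/-- The places of the blocks of `normalBlocks` that may be different from zero. -/
def normalSupport : Finset (Fin 8 × Fin 8) :=
  {(1, 2), (5, 6), (1, 5), (1, 6), (2, 6), (3, 4), (0, 7)}

theorem normalBlocks_eq_zero (A : Matrix (Fin (blockSize m k 1)) (Fin (blockSize m k 2)) ℝ)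
    (C P Q R B D) (a b : Fin 8) (h : a ≠ b ∧ (a, b) ∉ normalSupport) :
    normalBlocks A C P Q R B D a b = 0 := by
  revert b
  revert a
  apply forall_fin_eight <;> apply forall_fin_eight <;> intro h <;>
    first
    | exact absurd h (by decide)
    | rfl

/-- The element of the group with the blocks `normalBlocks`. -/
noncomputable def normalForm (A : Matrix (Fin (blockSize m k 1)) (Fin (blockSize m k 2)) ℝ)
    (C : Matrix (Fin (blockSize m k 5)) (Fin (blockSize m k 6)) ℝ)
    (P : Matrix (Fin (blockSize m k 1)) (Fin (blockSize m k 5)) ℝ)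
    (Q : Matrix (Fin (blockSize m k 1)) (Fin (blockSize m k 6)) ℝ)
    (R : Matrix (Fin (blockSize m k 2)) (Fin (blockSize m k 6)) ℝ)
    (B : Matrix (Fin (blockSize m k 3)) (Fin (blockSize m k 4)) ℝ)
    (D : Matrix (Fin (blockSize m k 0)) (Fin (blockSize m k 7)) ℝ) : UT (matSize m k) :=
  ⟨ofBlocks m k (normalBlocks A C P Q R B D), mem_UT_of_blk
    (fun a => by rw [blk_ofBlocks, normalBlocks_self]; exact one_mem _)
    (fun a b h => by rw [blk_ofBlocks, normalBlocks_lower _ _ _ _ _ _ _ _ _ h])⟩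

theorem blk_normalForm (A : Matrix (Fin (blockSize m k 1)) (Fin (blockSize m k 2)) ℝ)
    (C P Q R B D) (a b : Fin 8) :
    blk a b (normalForm A C P Q R B D : Matrix (Fin (matSize m k)) (Fin (matSize m k)) ℝ) =
      normalBlocks A C P Q R B D a b :=
  blk_ofBlocks a b _

theorem continuous_ofBlocks {T : Type*} [TopologicalSpace T]
    {M : T → ∀ a b : Fin 8, Matrix (Fin (blockSize m k a)) (Fin (blockSize m k b)) ℝ}
    (h : ∀ a b, Continuous fun t => M t a b) : Continuous fun t => ofBlocks m k (M t) := by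
  refine continuous_matrix fun u v => ?_
  obtain ⟨a, i, rfl⟩ := exists_pos u
  obtain ⟨b, j, rfl⟩ := exists_pos v
  have : (fun t => ofBlocks m k (M t) (pos m k a i) (pos m k b j)) = fun t => M t a b i j := by
    funext t
    exact congrFun (congrFun (blk_ofBlocks a b (M t)) i) j
  rw [this]
  exact (h a b).matrix_elem i j

theorem continuous_normalForm {T : Type*} [TopologicalSpace T]
    {A : T → Matrix (Fin (blockSize m k 1)) (Fin (blockSize m k 2)) ℝ}
    {C : T → Matrix (Fin (blockSize m k 5)) (Fin (blockSize m k 6)) ℝ}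
    {P : Matrix (Fin (blockSize m k 1)) (Fin (blockSize m k 5)) ℝ}
    {Q : Matrix (Fin (blockSize m k 1)) (Fin (blockSize m k 6)) ℝ}
    {R : Matrix (Fin (blockSize m k 2)) (Fin (blockSize m k 6)) ℝ}
    {B : T → Matrix (Fin (blockSize m k 3)) (Fin (blockSize m k 4)) ℝ}
    {D : T → Matrix (Fin (blockSize m k 0)) (Fin (blockSize m k 7)) ℝ}
    (hA : Continuous A) (hC : Continuous C) (hB : Continuous B) (hD : Continuous D) :
    Continuous fun t => normalForm (A t) (C t) P Q R (B t) (D t) := by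
  refine Continuous.subtype_mk (continuous_ofBlocks ?_) _
  apply forall_fin_eight <;> apply forall_fin_eight <;>
    first
    | exact hA
    | exact hB
    | exact hC
    | exact hD
    | exact continuous_const

end Blocks

/-! ### Antidiagonal matrices -/

section Antidiag

variable {s : ℕ}

theorem antidiag_apply (l : Fin s → ℝ) (i j : Fin s) :
    antidiag l i j = if j = i.rev then l j else 0 := by
  have : ((i : ℕ) + j + 1 = s) ↔ j = i.rev := by
    rw [Fin.ext_iff, Fin.val_rev]
    omega
  simp only [antidiag, Matrix.of_apply, this]

theorem antidiag_mul_apply {t : ℕ} (l : Fin s → ℝ) (M : Matrix (Fin s) (Fin t) ℝ) (i : Fin s)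
    (j : Fin t) : (antidiag l * M) i j = l i.rev * M i.rev j := by
  simp [Matrix.mul_apply, antidiag_apply]

theorem mul_antidiag_apply {t : ℕ} (l : Fin s → ℝ) (M : Matrix (Fin t) (Fin s) ℝ) (i : Fin t)
    (j : Fin s) : (M * antidiag l) i j = M i j.rev * l j := by
  have : ∀ x : Fin s, (j = x.rev) ↔ x = j.rev := fun x => by
    rw [eq_comm, Fin.rev_eq_iff]
  simp [Matrix.mul_apply, antidiag_apply, this]

theorem antidiag_mul_eq_zero {t : ℕ} {l : Fin s → ℝ} (hl : ∀ j, l j ≠ 0)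
    {M : Matrix (Fin s) (Fin t) ℝ} (h : antidiag l * M = 0) : M = 0 := by
  ext i j
  have := congrFun (congrFun h i.rev) j
  rw [antidiag_mul_apply, Fin.rev_rev] at this
  exact (mul_eq_zero.1 this).resolve_left (hl i)

theorem mul_antidiag_eq_zero {t : ℕ} {l : Fin s → ℝ} (hl : ∀ j, l j ≠ 0)
    {M : Matrix (Fin t) (Fin s) ℝ} (h : M * antidiag l = 0) : M = 0 := by
  ext i j
  have := congrFun (congrFun h i) j.rev
  rw [mul_antidiag_apply, Fin.rev_rev] at this
  exact (mul_eq_zero.1 this).resolve_right (hl _)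

/-- Unitriangular matrices intertwined by an antidiagonal matrix are trivial. -/
theorem eq_one_of_mul_antidiag_eq {l : Fin s → ℝ} (hl : ∀ j : Fin s, (j : ℕ) + 1 < s → l j ≠ 0)
    {U V : Matrix (Fin s) (Fin s) ℝ} (hU : U ∈ UT s) (hV : V ∈ UT s)
    (h : U * antidiag l = antidiag l * V) : U = 1 ∧ V = 1 := by
  -- The left side of `h` lives on and above the second diagonal, the right side on and below it, so
  -- off the second diagonal both vanish.
  have key : ∀ i j, U i j.rev * l j = l i.rev * V i.rev j := fun i j => by
    rw [← mul_antidiag_apply, h, antidiag_mul_apply]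
  constructor
  · ext i j
    rcases lt_trichotomy i j with hij | rfl | hij
    · have := key i j.rev
      rw [Fin.rev_rev, hV.2 _ _ (Fin.rev_lt_rev.2 hij), mul_zero] at this
      rw [Matrix.one_apply_ne hij.ne]
      refine (mul_eq_zero.1 this).resolve_right (hl _ ?_)
      -- Since `i < j`, the index `j.rev` is not the last one, so the possibly zero entry in the
      -- upper right corner is never divided by.
      rw [Fin.val_rev]
      have := j.2
      omega
    · rw [hU.1, Matrix.one_apply_eq]
    · rw [hU.2 _ _ hij, Matrix.one_apply_ne hij.ne']
  · ext i j
    rcases lt_trichotomy i j with hij | rfl | hij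
    · have := key i.rev j
      rw [Fin.rev_rev, hU.2 _ _ (Fin.rev_lt_rev.2 hij), zero_mul, eq_comm] at this
      rw [Matrix.one_apply_ne hij.ne]
      refine (mul_eq_zero.1 this).resolve_left (hl _ ?_)
      have := j.2
      omega
    · rw [hV.1, Matrix.one_apply_eq]
    · rw [hV.2 _ _ hij, Matrix.one_apply_ne hij.ne']

/-- Right multiplication by `antidiag l` reverses the columns, so `h₁` kills the part of `X` below
the second diagonal; left multiplication reverses the rows, so `h₂` kills the part above it. Neither
uses the last entry of `l`. -/
theorem exists_eq_antidiag {l : Fin s → ℝ} (hl : ∀ j : Fin s, (j : ℕ) + 1 < s → l j ≠ 0)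
    {X : Matrix (Fin s) (Fin s) ℝ} (h₁ : ∀ i j, j < i → (X * antidiag l) i j = 0)
    (h₂ : ∀ i j, j < i → (antidiag l * X) i j = 0) : ∃ x, X = antidiag x := by
  refine ⟨fun j => X j.rev j, ?_⟩
  ext i j
  rw [antidiag_apply]
  split_ifs with hj
  · rw [hj, Fin.rev_rev]
  · rcases lt_or_gt_of_ne hj with hj | hj
    · have := h₂ i.rev j hj
      rw [antidiag_mul_apply, Fin.rev_rev] at this
      refine (mul_eq_zero.1 this).resolve_left (hl _ ?_)
      have := Fin.lt_def.1 hj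
      rw [Fin.val_rev] at this
      omega
    · have hj' : j.rev < i := by rw [← Fin.rev_lt_rev, Fin.rev_rev]; exact hj
      have := h₁ i j.rev hj'
      rw [mul_antidiag_apply, Fin.rev_rev] at this
      refine (mul_eq_zero.1 this).resolve_right (hl _ ?_)
      have := Fin.lt_def.1 hj'
      have := i.2
      omega

theorem antidiag_mul_antidiag_lower (a b : Fin s → ℝ) {i j : Fin s} (h : j < i) :
    (antidiag a * antidiag b) i j = 0 := by
  rw [antidiag_mul_apply, antidiag_apply, Fin.rev_rev, if_neg h.ne, mul_zero]

theorem det_antidiag_ne_zero {l : Fin s → ℝ} (hl : ∀ j, l j ≠ 0) : (antidiag l).det ≠ 0 := by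
  have : antidiag l * antidiag (fun j => (l j.rev)⁻¹) = 1 := by
    ext i j
    rw [antidiag_mul_apply, antidiag_apply, Fin.rev_rev, Matrix.one_apply]
    by_cases h : j = i
    · subst h; simp [hl]
    · simp [h, Ne.symm h]
  exact fun h0 => by simpa [h0] using congrArg Matrix.det this

theorem continuous_antidiag : Continuous (antidiag : (Fin s → ℝ) → Matrix (Fin s) (Fin s) ℝ) := by
  refine continuous_matrix fun i j => ?_
  simp only [antidiag_apply]
  split_ifs
  · exact continuous_apply j
  · exact continuous_const

/-! ### The big cell -/

/-- The matrices `U A V` with `U`, `V` unitriangular and `A` antidiagonal. -/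
def bigCell (s : ℕ) : Set (Matrix (Fin s) (Fin s) ℝ) :=
  {B | ∃ U V : UT s, ∃ b, B = U.1 * antidiag b * V.1}

theorem mul_mem_closure_bigCell (U V : UT s) {B : Matrix (Fin s) (Fin s) ℝ}
    (hB : B ∈ closure (bigCell s)) :
    U.1 * B * V.1 ∈ closure (bigCell s) := by
  have hc : Continuous fun B : Matrix (Fin s) (Fin s) ℝ =>
      U.1 * B * V.1 := by fun_prop
  refine map_mem_closure (f := fun B => U.1 * B * V.1) hc hB ?_
  rintro _ ⟨U', V', b, rfl⟩
  exact ⟨U * U', V' * V, b, by simp only [Submonoid.coe_mul, Matrix.mul_assoc]⟩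

/-- The matrix with the entry `β` in the lower left corner, the block `B` in the upper right
corner, and zeros elsewhere. -/
def cornerMatrix (β : ℝ) (B : Matrix (Fin s) (Fin s) ℝ) : Matrix (Fin (s + 1)) (Fin (s + 1)) ℝ :=
  Matrix.of fun i j => Fin.lastCases (motive := fun _ => ℝ) (Fin.cases β (fun _ => 0) j)
    (fun i' => Fin.cases 0 (fun j' => B i' j') j) i

/-- `U ↦ diag(U, 1)`. -/
def extendLast (U : Matrix (Fin s) (Fin s) ℝ) : Matrix (Fin (s + 1)) (Fin (s + 1)) ℝ :=
  Matrix.of fun i j => Fin.lastCases (motive := fun _ => ℝ)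
    (Fin.lastCases (motive := fun _ => ℝ) 1 (fun _ => 0) j)
    (fun i' => Fin.lastCases (motive := fun _ => ℝ) 0 (fun j' => U i' j') j) i

/-- `V ↦ diag(1, V)`. -/
def extendFirst (V : Matrix (Fin s) (Fin s) ℝ) : Matrix (Fin (s + 1)) (Fin (s + 1)) ℝ :=
  Matrix.of fun i j => Fin.cases (Fin.cases 1 (fun _ => 0) j)
    (fun i' => Fin.cases 0 (fun j' => V i' j') j) i

theorem extendLast_mem (U : UT s) : extendLast (U : Matrix (Fin s) (Fin s) ℝ) ∈ UT (s + 1) := by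
  constructor
  · intro i
    induction i using Fin.lastCases with
    | last => simp [extendLast]
    | cast i => simpa [extendLast] using U.2.1 i
  · intro i j h
    induction i using Fin.lastCases with
    | last =>
      induction j using Fin.lastCases with
      | last => exact absurd h (lt_irrefl _)
      | cast j => simp [extendLast]
    | cast i =>
      induction j using Fin.lastCases with
      | last => exact absurd h (Fin.castSucc_lt_last i).not_gt
      | cast j => simpa [extendLast] using U.2.2 i j (Fin.castSucc_lt_castSucc_iff.1 h)

theorem extendFirst_mem (V : UT s) : extendFirst (V : Matrix (Fin s) (Fin s) ℝ) ∈ UT (s + 1) := by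
  constructor
  · intro i
    induction i using Fin.cases with
    | zero => simp [extendFirst]
    | succ i => simpa [extendFirst] using V.2.1 i
  · intro i j h
    induction i using Fin.cases with
    | zero => exact absurd h (Fin.not_lt_zero j)
    | succ i =>
      induction j using Fin.cases with
      | zero => simp [extendFirst]
      | succ j => simpa [extendFirst] using V.2.2 i j (Fin.succ_lt_succ_iff.1 h)

/-- Unitriangular factors of the smaller block extend to unitriangular factors of the larger matrix
without touching the corner entry. This carries the induction in `dense_bigCell`. -/
theorem cornerMatrix_mul (β : ℝ) (U B V : Matrix (Fin s) (Fin s) ℝ) :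
    cornerMatrix β (U * B * V) = extendLast U * cornerMatrix β B * extendFirst V := by
  have h : cornerMatrix β (U * B) = extendLast U * cornerMatrix β B := by
    ext i j
    rw [Matrix.mul_apply, Fin.sum_univ_castSucc]
    induction i using Fin.lastCases <;> induction j using Fin.cases <;>
      simp [cornerMatrix, extendLast, Matrix.mul_apply]
  rw [← h]
  ext i j
  rw [Matrix.mul_apply, Fin.sum_univ_succ]
  induction i using Fin.lastCases <;> induction j using Fin.cases <;>
    simp [cornerMatrix, extendFirst, Matrix.mul_apply]

theorem cornerMatrix_antidiag (β : ℝ) (b : Fin s → ℝ) :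
    cornerMatrix β (antidiag b) = antidiag (Fin.cases β b : Fin (s + 1) → ℝ) := by
  ext i j
  induction i using Fin.lastCases with
  | last =>
    induction j using Fin.cases with
    | zero => simp [cornerMatrix, antidiag]
    | succ j => simp [cornerMatrix, antidiag]
  | cast i =>
    induction j using Fin.cases with
    | zero => simp [cornerMatrix, antidiag, i.2.ne]
    | succ j => simp [cornerMatrix, antidiag, ← add_assoc]

theorem cornerMatrix_mem_closure {B : Matrix (Fin s) (Fin s) ℝ} (hB : B ∈ closure (bigCell s))
    (β : ℝ) : cornerMatrix β B ∈ closure (bigCell (s + 1)) := by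
  have hc : Continuous (cornerMatrix (s := s) β) := by
    refine continuous_matrix fun i j => ?_
    induction i using Fin.lastCases <;> induction j using Fin.cases <;>
      simp only [cornerMatrix, Matrix.of_apply, Fin.lastCases_last, Fin.lastCases_castSucc,
        Fin.cases_zero, Fin.cases_succ]
    · exact continuous_const
    · exact continuous_const
    · exact continuous_const
    · exact continuous_id.matrix_elem _ _
  refine map_mem_closure hc hB ?_
  rintro _ ⟨U, V, b, rfl⟩
  refine ⟨⟨_, extendLast_mem U⟩, ⟨_, extendFirst_mem V⟩, Fin.cases β b, ?_⟩
  rw [cornerMatrix_mul, cornerMatrix_antidiag]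

/-- `diag(1, …, 1)` with the last column replaced by `(u, 1)`. -/
def lastColumn (u : Fin s → ℝ) : Matrix (Fin (s + 1)) (Fin (s + 1)) ℝ :=
  Matrix.of fun i j => Fin.lastCases (motive := fun _ => ℝ)
    (Fin.lastCases (motive := fun _ => ℝ) 1 u i) (fun j' => if i = j'.castSucc then 1 else 0) j

/-- `diag(1, …, 1)` with the first row replaced by `(1, v)`. -/
def firstRow (v : Fin s → ℝ) : Matrix (Fin (s + 1)) (Fin (s + 1)) ℝ :=
  Matrix.of fun i j => Fin.cases (Fin.cases 1 v j) (fun i' => if j = i'.succ then 1 else 0) i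

theorem lastColumn_mem (u : Fin s → ℝ) : lastColumn u ∈ UT (s + 1) := by
  constructor
  · intro i
    induction i using Fin.lastCases <;> simp [lastColumn]
  · intro i j h
    induction j using Fin.lastCases with
    | last => exact absurd h (Fin.le_last i).not_gt
    | cast j => simp [lastColumn, h.ne']

theorem firstRow_mem (v : Fin s → ℝ) : firstRow v ∈ UT (s + 1) := by
  constructor
  · intro i
    induction i using Fin.cases <;> simp [firstRow]
  · intro i j h
    induction i using Fin.cases with
    | zero => exact absurd h (Fin.not_lt_zero j)
    | succ i => simp [firstRow, h.ne]

theorem lastColumn_mul_castSucc (u : Fin s → ℝ) (M : Matrix (Fin (s + 1)) (Fin (s + 1)) ℝ)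
    (i : Fin s) (j : Fin (s + 1)) :
    (lastColumn u * M) i.castSucc j = M i.castSucc j + u i * M (Fin.last s) j := by
  simp [Matrix.mul_apply, Fin.sum_univ_castSucc, lastColumn]

theorem lastColumn_mul_last (u : Fin s → ℝ) (M : Matrix (Fin (s + 1)) (Fin (s + 1)) ℝ)
    (j : Fin (s + 1)) : (lastColumn u * M) (Fin.last s) j = M (Fin.last s) j := by
  have : ∀ x : Fin s, Fin.last s ≠ x.castSucc := fun x => (Fin.castSucc_lt_last x).ne'
  simp [Matrix.mul_apply, Fin.sum_univ_castSucc, lastColumn, this]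

theorem mul_firstRow_succ (v : Fin s → ℝ) (M : Matrix (Fin (s + 1)) (Fin (s + 1)) ℝ)
    (i : Fin (s + 1)) (j : Fin s) :
    (M * firstRow v) i j.succ = M i 0 * v j + M i j.succ := by
  simp [Matrix.mul_apply, Fin.sum_univ_succ, firstRow]

theorem mul_firstRow_zero (v : Fin s → ℝ) (M : Matrix (Fin (s + 1)) (Fin (s + 1)) ℝ)
    (i : Fin (s + 1)) : (M * firstRow v) i 0 = M i 0 := by
  have : ∀ x : Fin s, (0 : Fin (s + 1)) ≠ x.succ := fun x => (Fin.succ_ne_zero x).symm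
  simp [Matrix.mul_apply, Fin.sum_univ_succ, firstRow, this]

/-- One step of Gaussian elimination with the lower left entry as pivot: the rest of the first
column and of the last row is cleared by unitriangular factors, leaving the Schur complement in the
upper right block. -/
theorem eq_lastColumn_mul {B : Matrix (Fin (s + 1)) (Fin (s + 1)) ℝ} (hB : B (Fin.last s) 0 ≠ 0) :
    B = lastColumn (fun i => B i.castSucc 0 / B (Fin.last s) 0) *
      cornerMatrix (B (Fin.last s) 0) (Matrix.of fun i j =>
        B i.castSucc j.succ - B i.castSucc 0 / B (Fin.last s) 0 * B (Fin.last s) j.succ) *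
      firstRow (fun j => B (Fin.last s) j.succ / B (Fin.last s) 0) := by
  ext i j
  induction i using Fin.lastCases with
  | last =>
    rw [Matrix.mul_assoc, lastColumn_mul_last]
    induction j using Fin.cases with
    | zero => rw [mul_firstRow_zero]; simp [cornerMatrix]
    | succ j => rw [mul_firstRow_succ]; simp [cornerMatrix, mul_div_cancel₀ _ hB]
  | cast i =>
    rw [Matrix.mul_assoc, lastColumn_mul_castSucc]
    induction j using Fin.cases with
    | zero => simp only [mul_firstRow_zero]; simp [cornerMatrix, hB]
    | succ j => simp only [mul_firstRow_succ]; simp [cornerMatrix]; field_simp; ring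

/-- Induction on the size. With a nonzero lower left entry, elimination reduces to the Schur
complement, which is a limit of big cell matrices by induction; that entry can be made nonzero by an
arbitrarily small change. -/
theorem dense_bigCell (s : ℕ) : Dense (bigCell s) := by
  induction s with
  | zero => exact fun B => subset_closure ⟨1, 1, 0, Subsingleton.elim _ _⟩
  | succ s ih =>
    have key : ∀ B : Matrix (Fin (s + 1)) (Fin (s + 1)) ℝ, B (Fin.last s) 0 ≠ 0 →
        B ∈ closure (bigCell (s + 1)) := fun B hB => by
      rw [eq_lastColumn_mul hB]
      exact mul_mem_closure_bigCell ⟨_, lastColumn_mem _⟩ ⟨_, firstRow_mem _⟩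
        (cornerMatrix_mem_closure (ih _) _)
    intro B
    let E : ℝ → Matrix (Fin (s + 1)) (Fin (s + 1)) ℝ :=
      fun t => B + t • Matrix.single (Fin.last s) 0 1
    have hE : Continuous E := by fun_prop
    have h0 : B = E 0 := by simp [E]
    rw [h0, ← closure_closure]
    refine map_mem_closure hE (dense_compl_singleton (-(B (Fin.last s) 0)) 0) fun t ht => ?_
    refine key _ fun h => ht ?_
    simp only [E, Matrix.add_apply, Matrix.smul_apply, Matrix.single_apply_same, smul_eq_mul,
      mul_one] at h
    exact (neg_eq_of_add_eq_zero_right h).symm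

end Antidiag

/-! ### The stabilizer -/

section Stabilizer

theorem UT.blockTriangular {n : ℕ} (g : UT n) : g.1.BlockTriangular id := fun i j h => g.2.2 i j h

theorem UT.coe_mul_coe_inv {n : ℕ} (g : UT n) : g.1 * (g⁻¹).1 = 1 :=
  congrArg Subtype.val (mul_inv_cancel g)

theorem UT.coe_inv_mul_coe {n : ℕ} (g : UT n) : (g⁻¹).1 * g.1 = 1 :=
  congrArg Subtype.val (inv_mul_cancel g)

theorem coadj_traceDual_apply {n : ℕ} (g : UT n) (F : Matrix (Fin n) (Fin n) ℝ) (x : ut n) :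
    coadj g (traceDual F) x = (g.1 * F * (g⁻¹).1 * x.1).trace := by
  have : coadj g (traceDual F) x = (F * ((g⁻¹).1 * x.1 * (g⁻¹⁻¹).1)).trace := rfl
  rw [this, inv_inv, ← Matrix.mul_assoc, Matrix.trace_mul_comm]
  simp only [Matrix.mul_assoc]

/-- The trace form pairs strictly upper triangular matrices perfectly with strictly lower ones, so
only the part of `gFg⁻¹ - F` below the diagonal matters. Multiplying on the right by `g` preserves
upper triangularity and makes the condition linear in `g`. -/
theorem mem_coadjStabilizer_iff {n : ℕ} (F : Matrix (Fin n) (Fin n) ℝ) (g : UT n) :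
    g ∈ coadjStabilizer (traceDual F) ↔ (g.1 * F - F * g.1).BlockTriangular id := by
  have h1 : (g.1 * F * (g⁻¹).1 - F) * g.1 = g.1 * F - F * g.1 := by
    rw [Matrix.sub_mul, Matrix.mul_assoc (g.1 * F), UT.coe_inv_mul_coe, Matrix.mul_one]
  have h2 : (g.1 * F - F * g.1) * (g⁻¹).1 = g.1 * F * (g⁻¹).1 - F := by
    rw [← h1, Matrix.mul_assoc, UT.coe_mul_coe_inv, Matrix.mul_one]
  have h3 : (g.1 * F - F * g.1).BlockTriangular id ↔
      (g.1 * F * (g⁻¹).1 - F).BlockTriangular id :=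
    ⟨fun h => h2 ▸ h.mul (UT.blockTriangular _), fun h => h1 ▸ h.mul (UT.blockTriangular _)⟩
  rw [h3]
  constructor
  · intro h i j hij
    -- Testing against the elementary matrix at `(j, i)` reads off the entry at `(i, j)`.
    have hx : Matrix.single j i (1 : ℝ) ∈ ut n := fun a b hab =>
      Matrix.single_apply_of_ne _ _ _ _ _ fun h => by
        obtain ⟨rfl, rfl⟩ := h; exact absurd hij (not_lt.2 hab)
    have h' := LinearMap.congr_fun h ⟨_, hx⟩
    rw [coadj_traceDual_apply] at h'
    have h'' : (g.1 * F * (g⁻¹).1 * Matrix.single j i (1 : ℝ)).trace =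
      (F * Matrix.single j i (1 : ℝ)).trace := h'
    rw [Matrix.trace_mul_single, Matrix.trace_mul_single] at h''
    simpa [sub_eq_zero] using h''
  · intro h
    ext x
    rw [coadj_traceDual_apply]
    change _ = (F * x.1).trace
    rw [← sub_eq_zero, ← Matrix.trace_sub, ← Matrix.sub_mul, Matrix.trace]
    refine Finset.sum_eq_zero fun i _ => ?_
    rw [Matrix.diag_apply, Matrix.mul_apply]
    refine Finset.sum_eq_zero fun j _ => ?_
    rcases lt_or_ge j i with hij | hij
    · rw [h hij, zero_mul]
    · rw [x.2 j i hij, mul_zero]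

variable {m k : ℕ}

/-- The block `Λ₁`. -/
def blockL1 (k : ℕ) (l : Fin m → ℝ) :
    Matrix (Fin (blockSize m k 7)) (Fin (blockSize m k 0)) ℝ := antidiag l

/-- The block `Λ₂`. -/
def blockL2 (m : ℕ) (l : Fin k → ℝ) :
    Matrix (Fin (blockSize m k 4)) (Fin (blockSize m k 3)) ℝ := antidiag l

/-- An antidiagonal block at place `(1, 8)`. -/
def blockD (k : ℕ) (l : Fin m → ℝ) :
    Matrix (Fin (blockSize m k 0)) (Fin (blockSize m k 7)) ℝ := antidiag l

/-- An antidiagonal block at place `(4, 5)`. -/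
def blockB (m : ℕ) (l : Fin k → ℝ) :
    Matrix (Fin (blockSize m k 3)) (Fin (blockSize m k 4)) ℝ := antidiag l

section

variable (l₁ : Fin m → ℝ) (l₂ : Fin k → ℝ) (γ₁ γ₂ γ₃ : ℝ)

theorem blk_fMatrix_70 : blk 7 0 (fMatrix m k l₁ l₂ γ₁ γ₂ γ₃) = blockL1 k l₁ := blk_ofBlocks 7 0 _

theorem blk_fMatrix_43 : blk 4 3 (fMatrix m k l₁ l₂ γ₁ γ₂ γ₃) = blockL2 m l₂ := blk_ofBlocks 4 3 _

theorem blk_fMatrix_51 : blk 5 1 (fMatrix m k l₁ l₂ γ₁ γ₂ γ₃) = Matrix.of fun _ _ => γ₁ :=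
  blk_ofBlocks 5 1 _

theorem blk_fMatrix_62 : blk 6 2 (fMatrix m k l₁ l₂ γ₁ γ₂ γ₃) = Matrix.of fun _ _ => γ₂ :=
  blk_ofBlocks 6 2 _

theorem blk_fMatrix_65 : blk 6 5 (fMatrix m k l₁ l₂ γ₁ γ₂ γ₃) = Matrix.of fun _ _ => γ₃ :=
  blk_ofBlocks 6 5 _

/-- The places of the blocks of `fMatrix` that may be different from zero. -/
def fSupport : Finset (Fin 8 × Fin 8) := {(7, 0), (4, 3), (5, 1), (6, 2), (6, 5)}

theorem blk_fMatrix_eq_zero (a b : Fin 8) (h : (a, b) ∉ fSupport) :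
    blk a b (fMatrix m k l₁ l₂ γ₁ γ₂ γ₃) = 0 := by
  rw [fMatrix, blk_ofBlocks]
  revert b
  revert a
  apply forall_fin_eight <;> apply forall_fin_eight <;> intro h <;>
    first
    | exact absurd h (by decide)
    | rfl

end

theorem blockTriangular_iff_blk {P : Matrix (Fin (matSize m k)) (Fin (matSize m k)) ℝ} :
    P.BlockTriangular id ↔
      (∀ a b, b < a → blk a b P = 0) ∧ ∀ a i j, j < i → blk a a P i j = 0 := by
  constructor
  · intro h
    refine ⟨fun a b hab => ?_, fun a i j hij => h (pos_lt_iff.2 hij)⟩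
    ext i j
    exact h (pos_lt_pos hab j i)
  · rintro ⟨h, h'⟩ u v huv
    obtain ⟨a, i, rfl⟩ := exists_pos u
    obtain ⟨b, j, rfl⟩ := exists_pos v
    rcases lt_trichotomy a b with hab | rfl | hab
    · exact absurd huv (pos_lt_pos hab i j).not_gt
    · exact h' a i j (pos_lt_iff.1 huv)
    · exact congrFun (congrFun (h a b hab) i) j

theorem mul_const_eq_zero {s t r : ℕ} (ht : t = 1) (hr : r = 1) {γ : ℝ} (hγ : γ ≠ 0)
    {M : Matrix (Fin s) (Fin t) ℝ}
    (h : M * (Matrix.of fun _ _ => γ : Matrix (Fin t) (Fin r) ℝ) = 0) : M = 0 := by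
  subst ht hr
  ext i j
  have := congrFun (congrFun h i) j
  rw [Subsingleton.elim j 0] at this ⊢
  simpa [Matrix.mul_apply, hγ] using this

theorem const_mul_eq_zero {s t r : ℕ} (ht : t = 1) (hr : r = 1) {γ : ℝ} (hγ : γ ≠ 0)
    {M : Matrix (Fin t) (Fin s) ℝ}
    (h : (Matrix.of fun _ _ => γ : Matrix (Fin r) (Fin t) ℝ) * M = 0) : M = 0 := by
  subst ht hr
  ext i j
  have := congrFun (congrFun h i) j
  rw [Subsingleton.elim i 0] at this ⊢
  simpa [Matrix.mul_apply, hγ] using this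

variable (P : Matrix (Fin (blockSize m k 1)) (Fin (blockSize m k 5)) ℝ)
  (Q : Matrix (Fin (blockSize m k 1)) (Fin (blockSize m k 6)) ℝ)
  (R : Matrix (Fin (blockSize m k 2)) (Fin (blockSize m k 6)) ℝ)

/-- The elements of the stabilizer of `f`. -/
noncomputable def stabElement (γ₁ γ₂ α : ℝ) (b : Fin k → ℝ) (d : Fin m → ℝ) : UT (matSize m k) :=
  normalForm (Matrix.of fun _ _ => α) (Matrix.of fun _ _ => γ₁ * α / γ₂) P Q R (blockB m b)
    (blockD k d)

theorem not_lt_of_size_eq_one {s : ℕ} (hs : s = 1) (i j : Fin s) : ¬ j < i := by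
  subst hs
  rw [Subsingleton.elim i j]
  exact lt_irrefl j

theorem stabElement_mem (l₁ : Fin m → ℝ) (l₂ : Fin k → ℝ) {γ₁ γ₂ γ₃ : ℝ} (hγ₂ : γ₂ ≠ 0) (α : ℝ)
    (b : Fin k → ℝ) (d : Fin m → ℝ) :
    stabElement P Q R γ₁ γ₂ α b d ∈
      coadjStabilizer (traceDual (fMatrix m k l₁ l₂ γ₁ γ₂ γ₃)) := by
  rw [mem_coadjStabilizer_iff, blockTriangular_iff_blk]
  constructor
  · apply forall_fin_eight <;> apply forall_fin_eight <;> intro h <;>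
    first
    | exact absurd h (by decide)
    | skip
    all_goals
      simp (disch := decide) only [blk_sub, blk_mul, Fin.sum_univ_eight, stabElement,
        blk_normalForm, normalBlocks_eq_zero, normalBlocks_self, blk_fMatrix_eq_zero,
        add_zero, zero_add, sub_self, Matrix.mul_zero, Matrix.zero_mul, Matrix.one_mul,
        Matrix.mul_one]
    -- The only block below the diagonal that does not cancel at once is (6,3), where the relation
    -- between the blocks (2,3) and (6,7) is needed.
    have h1 : ∀ x y z w : ℝ, x * y = z * w →
        (Matrix.of fun _ _ => x : Matrix (Fin 1) (Fin 1) ℝ) *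
          (Matrix.of fun _ _ => y : Matrix (Fin 1) (Fin 1) ℝ) -
        (Matrix.of fun _ _ => z : Matrix (Fin 1) (Fin 1) ℝ) *
          (Matrix.of fun _ _ => w : Matrix (Fin 1) (Fin 1) ℝ) = 0 := fun x y z w h => by
      ext i j
      simp [Matrix.mul_apply, h]
    rw [blk_fMatrix_51, blk_fMatrix_62]
    exact h1 _ _ _ _ (div_mul_cancel₀ _ hγ₂)
  · apply forall_fin_eight <;> intro i j hij <;>
    first
    | exact absurd hij (not_lt_of_size_eq_one rfl i j)
    | skip
    all_goals
      simp (disch := decide) only [blk_sub, blk_mul, Fin.sum_univ_eight, stabElement,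
        blk_normalForm, normalBlocks_eq_zero, normalBlocks_self, blk_fMatrix_eq_zero,
        add_zero, zero_add, sub_zero, zero_sub, Matrix.mul_zero, Matrix.mul_one, blk_fMatrix_70, blk_fMatrix_43, Matrix.neg_apply,
        neg_eq_zero]
    all_goals exact antidiag_mul_antidiag_lower _ _ hij

theorem eq_const_of_size_eq_one {s t : ℕ} (hs : s = 1) (ht : t = 1) (M : Matrix (Fin s) (Fin t) ℝ)
    (i : Fin s) (j : Fin t) : M = Matrix.of fun _ _ => M i j := by
  subst hs ht
  ext i' j'
  rw [Subsingleton.elim i' i, Subsingleton.elim j' j]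
  rfl

/-- `F` has so few nonzero blocks that each block of `gF - Fg` on or below the diagonal has very few
surviving terms. Each of them determines one block of `g` or one relation. -/
theorem eq_stabElement {l₁ : Fin m → ℝ} {l₂ : Fin k → ℝ} {γ₁ γ₂ γ₃ : ℝ}
    (hl₁ : ∀ j, l₁ j ≠ 0) (hl₂ : ∀ j : Fin k, (j : ℕ) + 1 < k → l₂ j ≠ 0)
    (hγ₁ : γ₁ ≠ 0) (hγ₂ : γ₂ ≠ 0) {g : UT (matSize m k)}
    (hg : g ∈ coadjStabilizer (traceDual (fMatrix m k l₁ l₂ γ₁ γ₂ γ₃))) :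
    ∃ P Q R α b d, g = stabElement P Q R γ₁ γ₂ α b d := by
  rw [mem_coadjStabilizer_iff, blockTriangular_iff_blk] at hg
  obtain ⟨hg, hd⟩ := hg
  simp only [blk_sub, blk_mul, Fin.sum_univ_eight] at hg hd
  -- In block column 1 of `gF - Fg`, off the corner, only `C_{a8} Λ₁` survives.
  have col : ∀ a : Fin 8, a ≠ 0 → a ≠ 7 → blk a 7 g.1 = 0 := by
    intro a h0 h7
    have := hg a 0 (Fin.pos_of_ne_zero h0)
    revert this h0 h7
    revert a
    apply forall_fin_eight <;> intro h0 h7 this <;>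
    first
    | exact absurd rfl h0
    | exact absurd rfl h7
    | skip
    all_goals
      simp (disch := decide) only [blk_fMatrix_eq_zero, blk_lower, add_zero, zero_add, sub_zero,
        Matrix.mul_zero, Matrix.zero_mul, blk_fMatrix_70] at this
      exact mul_antidiag_eq_zero hl₁ this
  have row : ∀ b : Fin 8, b ≠ 0 → b ≠ 7 → blk 0 b g.1 = 0 := by
    intro b h0 h7
    have := hg 7 b (lt_of_le_of_ne (Fin.le_last b) h7)
    revert this h0 h7
    revert b
    apply forall_fin_eight <;> intro h0 h7 this <;>
    first
    | exact absurd rfl h0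
    | exact absurd rfl h7
    | skip
    all_goals
      simp (disch := decide) only [blk_fMatrix_eq_zero, blk_lower, add_zero, zero_sub,
        Matrix.mul_zero, Matrix.zero_mul, blk_fMatrix_70, neg_eq_zero] at this
      exact antidiag_mul_eq_zero hl₁ this
  have h00 : blk 7 7 g.1 = 1 ∧ blk 0 0 g.1 = 1 := by
    have := hg 7 0 (by decide)
    simp (disch := decide) only [blk_fMatrix_eq_zero, blk_lower, add_zero,
      zero_add, Matrix.mul_zero, blk_fMatrix_70] at this
    exact eq_one_of_mul_antidiag_eq (fun j _ => hl₁ j) (blk_self_mem_UT g 7) (blk_self_mem_UT g 0)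
      (sub_eq_zero.1 this)
  have h33 : blk 4 4 g.1 = 1 ∧ blk 3 3 g.1 = 1 := by
    have := hg 4 3 (by decide)
    simp (disch := decide) only [blk_fMatrix_eq_zero, blk_lower, add_zero,
      zero_add, Matrix.mul_zero, Matrix.zero_mul, blk_fMatrix_43] at this
    exact eq_one_of_mul_antidiag_eq hl₂ (blk_self_mem_UT g 4) (blk_self_mem_UT g 3)
      (sub_eq_zero.1 this)
  have h13 : blk 1 3 g.1 = 0 := by
    have := hg 5 3 (by decide)
    simp (disch := decide) only [blk_fMatrix_eq_zero, blk_lower, blk_unit_size, add_zero,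
      zero_add, zero_sub, Matrix.mul_zero, Matrix.zero_mul, neg_eq_zero, blk_fMatrix_43, blk_fMatrix_51] at this
    exact const_mul_eq_zero rfl rfl hγ₁ this
  have h14 : blk 1 4 g.1 = 0 := by
    have := hg 5 4 (by decide)
    simp (disch := decide) only [blk_fMatrix_eq_zero, blk_lower, blk_unit_size, add_zero,
      zero_add, zero_sub, Matrix.mul_zero, Matrix.zero_mul, neg_eq_zero, blk_fMatrix_51] at this
    exact const_mul_eq_zero rfl rfl hγ₁ this
  have h23 : blk 2 3 g.1 = 0 := by
    have := hg 6 3 (by decide)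
    simp (disch := decide) only [blk_fMatrix_eq_zero, blk_lower, blk_unit_size, add_zero,
      zero_add, zero_sub, Matrix.mul_zero, Matrix.zero_mul, neg_eq_zero, blk_fMatrix_43, blk_fMatrix_62, blk_fMatrix_65] at this
    exact const_mul_eq_zero rfl rfl hγ₂ this
  have h24 : blk 2 4 g.1 = 0 := by
    have := hg 6 4 (by decide)
    simp (disch := decide) only [blk_fMatrix_eq_zero, blk_lower, blk_unit_size, add_zero,
      zero_add, zero_sub, Matrix.mul_zero, Matrix.zero_mul, neg_eq_zero, blk_fMatrix_62, blk_fMatrix_65] at this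
    exact const_mul_eq_zero rfl rfl hγ₂ this
  -- Here `γ₃` occurs in both products, multiplied by diagonal blocks equal to `1`, and cancels;
  -- this is why its value does not matter.
  have h25 : blk 2 5 g.1 = 0 := by
    have := hg 6 5 (by decide)
    simp (disch := decide) only [blk_fMatrix_eq_zero, blk_lower, blk_unit_size, add_zero,
      zero_add, Matrix.mul_zero, Matrix.zero_mul, Matrix.one_mul,
      Matrix.mul_one, neg_eq_zero, blk_fMatrix_62, blk_fMatrix_65, sub_add_cancel_right] at this
    exact const_mul_eq_zero rfl rfl hγ₂ this
  have h35 : blk 3 5 g.1 = 0 := by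
    have := hg 3 1 (by decide)
    simp (disch := decide) only [blk_fMatrix_eq_zero, blk_lower, blk_unit_size, add_zero,
      zero_add, sub_zero, Matrix.mul_zero, Matrix.zero_mul, Matrix.mul_one, blk_fMatrix_51] at this
    exact mul_const_eq_zero rfl rfl hγ₁ this
  have h45 : blk 4 5 g.1 = 0 := by
    have := hg 4 1 (by decide)
    simp (disch := decide) only [blk_fMatrix_eq_zero, blk_lower, blk_unit_size, add_zero,
      zero_add, sub_zero, Matrix.mul_zero, Matrix.zero_mul, Matrix.mul_one, blk_fMatrix_43, blk_fMatrix_51] at this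
    exact mul_const_eq_zero rfl rfl hγ₁ this
  have h36 : blk 3 6 g.1 = 0 := by
    have := hg 3 2 (by decide)
    simp (disch := decide) only [blk_fMatrix_eq_zero, blk_lower, blk_unit_size, add_zero,
      zero_add, sub_zero, Matrix.mul_zero, Matrix.zero_mul, Matrix.mul_one, blk_fMatrix_62] at this
    exact mul_const_eq_zero rfl rfl hγ₂ this
  have h46 : blk 4 6 g.1 = 0 := by
    have := hg 4 2 (by decide)
    simp (disch := decide) only [blk_fMatrix_eq_zero, blk_lower, blk_unit_size, add_zero,
      zero_add, sub_zero, Matrix.mul_zero, Matrix.zero_mul, Matrix.mul_one, blk_fMatrix_43, blk_fMatrix_62] at this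
    exact mul_const_eq_zero rfl rfl hγ₂ this
  -- The only equation that links two blocks above the diagonal; it leaves the single parameter `α`.
  have h56 : blk 5 6 g.1 * Matrix.of (fun _ _ => γ₂) = Matrix.of (fun _ _ => γ₁) * blk 1 2 g.1 := by
    have := hg 5 2 (by decide)
    simp (disch := decide) only [blk_fMatrix_eq_zero, blk_lower, blk_unit_size, add_zero,
      zero_add, Matrix.mul_zero, Matrix.zero_mul, Matrix.mul_one, blk_fMatrix_51,
      blk_fMatrix_62] at this
    exact sub_eq_zero.1 this
  have hB : ∃ b, blk 3 4 g.1 = blockB m b := by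
    refine exists_eq_antidiag hl₂ (fun i j hij => ?_) (fun i j hij => ?_)
    · have := hd 3 i j hij
      simp (disch := decide) only [blk_fMatrix_eq_zero, blk_lower, add_zero,
        zero_add, sub_zero, Matrix.mul_zero, Matrix.zero_mul, blk_fMatrix_43] at this
      exact this
    · have := hd 4 i j hij
      simp (disch := decide) only [blk_fMatrix_eq_zero, blk_lower, add_zero,
        zero_add, zero_sub, Matrix.mul_zero, Matrix.zero_mul, blk_fMatrix_43] at this
      exact neg_eq_zero.1 this
  have hD : ∃ d, blk 0 7 g.1 = blockD k d := by
    refine exists_eq_antidiag (fun j _ => hl₁ j) (fun i j hij => ?_) (fun i j hij => ?_)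
    · have := hd 0 i j hij
      simp (disch := decide) only [blk_fMatrix_eq_zero, blk_lower, add_zero,
        zero_add, sub_zero, Matrix.mul_zero, Matrix.zero_mul, blk_fMatrix_70] at this
      exact this
    · have := hd 7 i j hij
      simp (disch := decide) only [blk_fMatrix_eq_zero, blk_lower, add_zero,
        zero_sub, Matrix.mul_zero, Matrix.zero_mul, blk_fMatrix_70] at this
      exact neg_eq_zero.1 this
  obtain ⟨b, hb⟩ := hB
  obtain ⟨d, hd⟩ := hD
  have hA : blk 1 2 g.1 = Matrix.of fun _ _ => blk 1 2 g.1 (0 : Fin 1) (0 : Fin 1) :=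
    eq_const_of_size_eq_one rfl rfl _ _ _
  have hC : blk 5 6 g.1 = Matrix.of fun _ _ => γ₁ * blk 1 2 g.1 (0 : Fin 1) (0 : Fin 1) / γ₂ := by
    have h1 : blk 5 6 g.1 = Matrix.of fun _ _ => blk 5 6 g.1 (0 : Fin 1) (0 : Fin 1) :=
      eq_const_of_size_eq_one rfl rfl _ _ _
    have h2 : ∀ (x y : Matrix (Fin 1) (Fin 1) ℝ), x * Matrix.of (fun _ _ => γ₂) =
        Matrix.of (fun _ _ => γ₁) * y → x 0 0 = γ₁ * y 0 0 / γ₂ := fun x y h => by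
      have := congrFun (congrFun h 0) 0
      simp only [Matrix.mul_apply, Finset.univ_unique, Finset.sum_singleton,
        Matrix.of_apply] at this
      rw [eq_div_iff hγ₂]
      exact this
    rw [h1]
    exact congrArg (fun z : ℝ => Matrix.of fun _ _ => z) (h2 _ _ h56)
  refine ⟨blk 1 5 g.1, blk 1 6 g.1, blk 2 6 g.1, blk 1 2 g.1 (0 : Fin 1) (0 : Fin 1), b, d, Subtype.ext
    (blk_ext fun a c => ?_)⟩
  rw [stabElement, blk_normalForm]
  rcases lt_trichotomy a c with hac | rfl | hac
  · revert hac
    revert c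
    revert a
    apply forall_fin_eight <;> apply forall_fin_eight <;> intro hac <;>
    first
    | exact absurd hac (by decide)
    | exact row _ (by decide) (by decide)
    | exact col _ (by decide) (by decide)
    | skip
    exacts [hd, hA, h13, h14, rfl, rfl, h23, h24, h25, rfl, hb, h35, h36, h45, h46, hC]
  · rw [normalBlocks_self]
    revert a
    apply forall_fin_eight
    exacts [h00.2, blk_unit_size g (by decide), blk_unit_size g (by decide), h33.2, h33.1,
      blk_unit_size g (by decide), blk_unit_size g (by decide), h00.1]
  · rw [blk_lower g hac, normalBlocks_lower _ _ _ _ _ _ _ _ _ hac]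

end Stabilizer

/-! ### The zero set of the ideal -/

section ZeroSet

variable {m k : ℕ}

theorem evalAt_genMatrix {n : ℕ} (g : UT n) (i j : Fin n) : evalAt g (genMatrix n i j) = g.1 i j := by
  simp only [genMatrix, Matrix.of_apply]
  split_ifs with h h'
  · simp [evalAt]
  · rw [map_one, h', g.2.1]
  · rw [map_zero, g.2.2]
    exact lt_of_le_of_ne (not_lt.1 h) (Ne.symm h')

theorem evalAt_det {n : ℕ} (g : UT n) {ι : Type*} [Fintype ι] [DecidableEq ι] (r c : ι → Fin n) :
    evalAt g ((genMatrix n).submatrix r c).det = (g.1.submatrix r c).det := by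
  rw [RingHom.map_det]
  congr 1
  ext i j
  exact evalAt_genMatrix g _ _

theorem evalAt_blockC (g : UT (matSize m k)) (a b : Fin 8) (i j) :
    evalAt g (blockC m k a b i j) = blk a b g.1 i j :=
  evalAt_genMatrix g _ _

/-- The only entry of a block of size one. -/
def entry {s t : ℕ} (hs : s = 1) (ht : t = 1) (M : Matrix (Fin s) (Fin t) ℝ) : ℝ :=
  M (Fin.cast hs.symm 0) (Fin.cast ht.symm 0)

theorem evalAt_det23 (g : UT (matSize m k)) :
    evalAt g (det23 m k) = entry rfl rfl (blk 1 2 g.1) :=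
  (congrArg (evalAt g) (Matrix.det_unique (n := Fin 1) _)).trans
    (evalAt_blockC g 1 2 _ _)

theorem evalAt_det67 (g : UT (matSize m k)) :
    evalAt g (det67 m k) = entry rfl rfl (blk 5 6 g.1) :=
  (congrArg (evalAt g) (Matrix.det_unique (n := Fin 1) _)).trans
    (evalAt_blockC g 5 6 _ _)

theorem evalAt_det45 (g : UT (matSize m k)) :
    evalAt g (det45 m k) = Matrix.det (n := Fin k) (blk 3 4 g.1) :=
  evalAt_det (ι := Fin k) g _ _

theorem evalLoc_algebraMap (g : UT (matSize m k)) (hg : evalAt g (denom m k) ≠ 0)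
    (x : CoordRing (matSize m k)) :
    evalLoc m k g hg (algebraMap _ (LocRing m k) x) = evalAt g x :=
  IsLocalization.Away.lift_eq _ _ x

/-- The value at `g` of the matrix of the minor `Δ(c)`. -/
def minorMatrix (a b : Fin 8) (P : Matrix (Fin (matSize m k)) (Fin (matSize m k)) ℝ) :
    Matrix (MinorIndex m k a b) (MinorIndex m k a b) ℝ :=
  P.submatrix (minorRow m k a b) (minorCol m k a b)

/-- The value at `g` of the matrix of the bordered minor of an entry. -/
def borderedMatrix (a b : Fin 8) (i : Fin (blockSize m k a)) (j : Fin (blockSize m k b))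
    (P : Matrix (Fin (matSize m k)) (Fin (matSize m k)) ℝ) :
    Matrix (Option (MinorIndex m k a b)) (Option (MinorIndex m k a b)) ℝ :=
  P.submatrix (fun x => x.elim (pos m k a i) (minorRow m k a b))
    (fun x => x.elim (pos m k b j) (minorCol m k a b))

theorem evalLoc_Delta_ne_zero (g : UT (matSize m k)) (hg : evalAt g (denom m k) ≠ 0) (a b : Fin 8) :
    (minorMatrix a b g.1).det ≠ 0 := by
  have := (Delta_isUnit m k a b).map (evalLoc m k g hg)
  rw [evalLoc_algebraMap, Delta, evalAt_det] at this
  exact this.ne_zero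

/-- `Δ(c)` is invertible in the localization, so dividing by it does not affect vanishing. -/
theorem evalLoc_cTilde_eq_zero_iff (g : UT (matSize m k)) (hg : evalAt g (denom m k) ≠ 0)
    (a b : Fin 8) (i : Fin (blockSize m k a)) (j : Fin (blockSize m k b)) :
    evalLoc m k g hg (cTilde m k a b i j) = 0 ↔ (borderedMatrix a b i j g.1).det = 0 := by
  have hu := ((Delta_isUnit m k a b).ringInverse).map (evalLoc m k g hg)
  rw [cTilde, map_mul, mul_eq_zero, or_iff_right hu.ne_zero, evalLoc_algebraMap,
    signedDeltaTilde, evalAt_det]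
  rfl

/-- Removes the localization and the ideal: from here on the zero set is given by real matrix
equations in the blocks of `g`. -/
theorem mem_zeroSet_iff (γ₁ γ₂ : ℝ) (g : UT (matSize m k)) :
    g ∈ zeroSet m k (idealI' m k γ₁ γ₂) ↔
      (entry rfl rfl (blk 1 2 g.1) ≠ 0 ∧ Matrix.det (n := Fin k) (blk 3 4 g.1) ≠ 0 ∧
        entry rfl rfl (blk 5 6 g.1) ≠ 0) ∧
      (∀ b ∈ ({0, 3, 4, 7} : Finset (Fin 8)), blk b b g.1 = 1) ∧
      (∀ p ∈ bulletBlocks, ∀ i j, (borderedMatrix p.1 p.2 i j g.1).det = 0) ∧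
      blk 1 2 g.1 * blk 2 4 g.1 + blk 1 3 g.1 * blk 3 4 g.1 = 0 ∧
      blk 3 4 g.1 * blk 4 6 g.1 + blk 3 5 g.1 * blk 5 6 g.1 = 0 ∧
      γ₁ * entry rfl rfl (blk 1 2 g.1) - γ₂ * entry rfl rfl (blk 5 6 g.1) = 0 := by
  have hd : evalAt g (denom m k) ≠ 0 ↔ (entry rfl rfl (blk 1 2 g.1) ≠ 0 ∧
      Matrix.det (n := Fin k) (blk 3 4 g.1) ≠ 0 ∧ entry rfl rfl (blk 5 6 g.1) ≠ 0) := by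
    rw [denom, map_mul, map_mul, evalAt_det23, evalAt_det45, evalAt_det67, mul_ne_zero_iff,
      mul_ne_zero_iff, and_assoc]
  rw [← hd]
  -- Vanishing on generators is enough because the kernel of the evaluation is an ideal.
  have hspan : ∀ hg : evalAt g (denom m k) ≠ 0,
      (∀ φ ∈ idealI' m k γ₁ γ₂, evalLoc m k g hg φ = 0) ↔
        ∀ φ ∈ S0 m k ∪ S1 m k ∪ S2 m k γ₁ γ₂, evalLoc m k g hg φ = 0 := fun hg =>
    Ideal.span_le (I := RingHom.ker (evalLoc m k g hg))
  have heval : ∀ (a c d e : Fin 8) (i j), evalAt g ((blockC m k a c * blockC m k c d +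
      blockC m k a e * blockC m k e d) i j) =
      (blk a c g.1 * blk c d g.1 + blk a e g.1 * blk e d g.1) i j := fun a c d e i j => by
    simp only [Matrix.add_apply, Matrix.mul_apply, map_add, map_sum, map_mul, evalAt_blockC]
  have hlast : evalAt g (MvPolynomial.C γ₁ * det23 m k - MvPolynomial.C γ₂ * det67 m k) =
      γ₁ * entry rfl rfl (blk 1 2 g.1) - γ₂ * entry rfl rfl (blk 5 6 g.1) := by
    rw [map_sub, map_mul, map_mul, evalAt_det23, evalAt_det67]
    simp [evalAt]
  constructor
  · rintro ⟨hg, h⟩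
    rw [hspan hg] at h
    refine ⟨hg, fun b hb => ?_, fun p hp i j => ?_, ?_, ?_, ?_⟩
    · ext i j
      rcases lt_trichotomy i j with hij | rfl | hij
      · have := h _ (Or.inl (Or.inl ⟨b, hb, i, j, hij, rfl⟩))
        rw [evalLoc_algebraMap, evalAt_blockC] at this
        rw [this, Matrix.one_apply_ne hij.ne]
      · rw [(blk_self_mem_UT g b).1, Matrix.one_apply_eq]
      · rw [(blk_self_mem_UT g b).2 _ _ hij, Matrix.one_apply_ne hij.ne']
    · exact (evalLoc_cTilde_eq_zero_iff g hg _ _ i j).1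
        (h _ (Or.inl (Or.inr ⟨p, hp, i, j, rfl⟩)))
    · ext i j
      have := h _ (Or.inr (Or.inl (Or.inl ⟨i, j, rfl⟩)))
      rw [evalLoc_algebraMap, heval] at this
      exact this
    · ext i j
      have := h _ (Or.inr (Or.inl (Or.inr ⟨i, j, rfl⟩)))
      rw [evalLoc_algebraMap, heval] at this
      exact this
    · have := h _ (Or.inr (Or.inr rfl))
      rw [evalLoc_algebraMap, hlast] at this
      exact this
  · rintro ⟨hg, h0, h1, h2, h3, h4⟩
    refine ⟨hg, (hspan hg).2 ?_⟩
    rintro φ ((⟨b, hb, i, j, hij, rfl⟩ | ⟨p, hp, i, j, rfl⟩) | ((⟨i, j, rfl⟩ | ⟨i, j, rfl⟩) | rfl))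
    · rw [evalLoc_algebraMap, evalAt_blockC, h0 b hb, Matrix.one_apply_ne hij.ne]
    · exact (evalLoc_cTilde_eq_zero_iff g hg _ _ i j).2 (h1 p hp i j)
    · rw [evalLoc_algebraMap, heval, h2]; rfl
    · rw [evalLoc_algebraMap, heval, h3]; rfl
    · rw [evalLoc_algebraMap, hlast, h4]

end ZeroSet

/-! ### Bordered minors and Schur complements -/

section Schur

/-- Adding the combination of rows with coefficients `w` to the row `none` does not change the
determinant and clears that row outside the column `none`; the matrix becomes block triangular. -/
theorem det_option_eq {ι : Type*} [Fintype ι] [DecidableEq ι] (N : Matrix (Option ι) (Option ι) ℝ)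
    (w : ι → ℝ) (hw : ∀ x', N none (some x') + ∑ x, w x * N (some x) (some x') = 0) :
    N.det = (N.submatrix some some).det * (N none none + ∑ x, w x * N (some x) none) := by
  let c : Option ι → ℝ := fun x => x.elim 1 w
  have h1 := Matrix.det_updateRow_sum N none c
  rw [show c none = 1 from rfl, one_smul] at h1
  rw [← h1, ← Matrix.det_submatrix_equiv_self (Equiv.optionEquivSumPUnit.{0} ι).symm]
  have h2 : (N.updateRow none (∑ x, c x • N x)).submatrix (Equiv.optionEquivSumPUnit.{0} ι).symm
      (Equiv.optionEquivSumPUnit.{0} ι).symm =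
      Matrix.fromBlocks (N.submatrix some some) (Matrix.of fun x _ => N (some x) none) 0
        (Matrix.of fun _ _ : PUnit.{1} => N none none + ∑ x, w x * N (some x) none) := by
    ext (x | x) (y | y)
    · simp [Matrix.updateRow_apply]
    · simp [Matrix.updateRow_apply]
    · simpa [Matrix.updateRow_apply, Fintype.sum_option, c] using hw y
    · simp [Matrix.updateRow_apply, Fintype.sum_option, c]
  rw [h2, Matrix.det_fromBlocks_zero₂₁, Matrix.det_unique (Matrix.of fun _ _ : PUnit.{1} => _)]
  rfl

variable {m k : ℕ} {M : Matrix (Fin (matSize m k)) (Fin (matSize m k)) ℝ}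

theorem sum_minorIndex {a b : Fin 8} (i : Fin (blockSize m k a))
    (W : ∀ p : Fin 8, Matrix (Fin (blockSize m k a)) (Fin (blockSize m k p)) ℝ)
    (c : Fin 8) (j : Fin (blockSize m k c)) :
    ∑ x : MinorIndex m k a b, W x.1.1.1 i x.2 * M (minorRow m k a b x) (pos m k c j) =
      (∑ q ∈ Phi with a < q.1 ∧ q.2 < b, W q.1 * blk q.1 c M) i j := by
  rw [Fintype.sum_sigma, Matrix.sum_apply]
  rw [Finset.sum_subtype (p := fun p => p ∈ Phi ∧ a < p.1 ∧ p.2 < b) _ (fun x => by simp)]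
  rfl

/-- `W` collects, one block at a time, row operations that clear the columns of `Δ`. By
`det_option_eq` each bordered minor is `Δ` times the cleared entry, so its vanishing turns into a
linear block equation. -/
theorem schur_eq_zero (a b : Fin 8)
    (W : ∀ p : Fin 8, Matrix (Fin (blockSize m k a)) (Fin (blockSize m k p)) ℝ)
    (hW : ∀ p ∈ Phi, a < p.1 ∧ p.2 < b →
      blk a p.2 M + ∑ q ∈ Phi with a < q.1 ∧ q.2 < b, W q.1 * blk q.1 p.2 M = 0)
    (hΔ : (minorMatrix a b M).det ≠ 0) (hdet : ∀ i j, (borderedMatrix a b i j M).det = 0) :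
    blk a b M + ∑ q ∈ Phi with a < q.1 ∧ q.2 < b, W q.1 * blk q.1 b M = 0 := by
  ext i j
  have h := det_option_eq (borderedMatrix a b i j M) (fun x => W x.1.1.1 i x.2) fun x' => by
    have h1 := congrFun (congrFun (hW x'.1.1 x'.1.2.1 x'.1.2.2) i)
      (Fin.cast (blockSize_of_mem_Phi m k x'.1.2.1) x'.2)
    rw [Matrix.add_apply, ← sum_minorIndex (b := b)] at h1
    exact h1
  rw [hdet] at h
  have h2 := (mul_eq_zero.1 h.symm).resolve_left hΔ
  rw [Matrix.add_apply, ← sum_minorIndex (b := b)]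
  exact h2

theorem schur_eq_zero_of_empty {a b : Fin 8}
    (hΦ : (Phi.filter fun q => a < q.1 ∧ q.2 < b) = ∅)
    (hΔ : (minorMatrix a b M).det ≠ 0) (hdet : ∀ i j, (borderedMatrix a b i j M).det = 0) :
    blk a b M = 0 := by
  have := schur_eq_zero a b (fun _ => 0) (fun p hp h => by
    have : p ∈ (Phi.filter fun q => a < q.1 ∧ q.2 < b) := Finset.mem_filter.2 ⟨hp, h⟩
    rw [hΦ] at this
    exact absurd this (Finset.notMem_empty p)) hΔ hdet
  rwa [hΦ, Finset.sum_empty, add_zero] at this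

theorem schur_eq_zero_of_singleton {a b : Fin 8} (p q : Fin 8)
    (hΦ : (Phi.filter fun q => a < q.1 ∧ q.2 < b) = {(p, q)})
    (U : Matrix (Fin (blockSize m k a)) (Fin (blockSize m k p)) ℝ)
    (hU : blk a q M + U * blk p q M = 0)
    (hΔ : (minorMatrix a b M).det ≠ 0) (hdet : ∀ i j, (borderedMatrix a b i j M).det = 0) :
    blk a b M + U * blk p b M = 0 := by
  have := schur_eq_zero a b (Function.update (fun _ => 0) p U) (fun x hx h => by
    have : x ∈ (Phi.filter fun q => a < q.1 ∧ q.2 < b) := Finset.mem_filter.2 ⟨hx, h⟩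
    rw [hΦ, Finset.mem_singleton] at this
    subst this
    simpa only [hΦ, Finset.sum_singleton, Function.update_self] using hU) hΔ hdet
  simpa only [hΦ, Finset.sum_singleton, Function.update_self] using this

theorem schur_eq_zero_of_pair {a b : Fin 8} (p q p' q' : Fin 8) (hp : p ≠ p')
    (hΦ : (Phi.filter fun q => a < q.1 ∧ q.2 < b) = {(p, q), (p', q')})
    (U : Matrix (Fin (blockSize m k a)) (Fin (blockSize m k p)) ℝ)
    (U' : Matrix (Fin (blockSize m k a)) (Fin (blockSize m k p')) ℝ)
    (hU : blk a q M + (U * blk p q M + U' * blk p' q M) = 0)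
    (hU' : blk a q' M + (U * blk p q' M + U' * blk p' q' M) = 0)
    (hΔ : (minorMatrix a b M).det ≠ 0) (hdet : ∀ i j, (borderedMatrix a b i j M).det = 0) :
    blk a b M + (U * blk p b M + U' * blk p' b M) = 0 := by
  have hne : (p, q) ≠ (p', q') := fun h => hp (congrArg Prod.fst h)
  have := schur_eq_zero a b (Function.update (Function.update (fun _ => 0) p' U') p U)
    (fun x hx h => by
      have : x ∈ (Phi.filter fun q => a < q.1 ∧ q.2 < b) := Finset.mem_filter.2 ⟨hx, h⟩
      rw [hΦ, Finset.mem_insert, Finset.mem_singleton] at this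
      rcases this with rfl | rfl <;>
      simpa only [hΦ, Finset.sum_pair hne, Function.update_self,
        Function.update_of_ne hp.symm]) hΔ hdet
  simpa only [hΦ, Finset.sum_pair hne, Function.update_self, Function.update_of_ne hp.symm]
    using this

end Schur

/-! ### Reduction to the normal form -/

section Reduction

variable {m k : ℕ}

/-- The matrices of the size of the block at place `(a, b)`. -/
abbrev Block (m k : ℕ) (a b : Fin 8) : Type :=
  Matrix (Fin (blockSize m k a)) (Fin (blockSize m k b)) ℝ

/-- The blocks of the conjugating element. -/
def reductionBlocks (h01 : Block m k 0 1)
    (h03 : Block m k 0 3)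
    (h05 : Block m k 0 5)
    (h13 : Block m k 1 3)
    (h23 : Block m k 2 3)
    (h27 : Block m k 2 7)
    (h45 : Block m k 4 5)
    (h46 : Block m k 4 6)
    (h47 : Block m k 4 7)
    (h67 : Block m k 6 7) (a b : Fin 8) :
    Matrix (Fin (blockSize m k a)) (Fin (blockSize m k b)) ℝ :=
  match a, b with
  | 0, 1 => h01
  | 0, 3 => h03
  | 0, 5 => h05
  | 1, 3 => h13
  | 2, 3 => h23
  | 2, 7 => h27
  | 4, 5 => h45
  | 4, 6 => h46
  | 4, 7 => h47
  | 6, 7 => h67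
  | 0, 0 => 1
  | 1, 1 => 1
  | 2, 2 => 1
  | 3, 3 => 1
  | 4, 4 => 1
  | 5, 5 => 1
  | 6, 6 => 1
  | 7, 7 => 1
  | _, _ => 0

/-- The places of the blocks of `reductionBlocks` that may be different from zero. -/
def reductionSupport : Finset (Fin 8 × Fin 8) :=
  {(0, 1), (0, 3), (0, 5), (1, 3), (2, 3), (2, 7), (4, 5), (4, 6), (4, 7), (6, 7)}

theorem reductionBlocks_self (h01 : Block m k 0 1)
    (h03 h05 h13 h23 h27 h45 h46 h47 h67) (a : Fin 8) :
    reductionBlocks h01 h03 h05 h13 h23 h27 h45 h46 h47 h67 a a = 1 := by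
  revert a
  apply forall_fin_eight <;> rfl

theorem reductionBlocks_eq_zero (h01 : Block m k 0 1)
    (h03 h05 h13 h23 h27 h45 h46 h47 h67) (a b : Fin 8) (h : a ≠ b ∧ (a, b) ∉ reductionSupport) :
    reductionBlocks h01 h03 h05 h13 h23 h27 h45 h46 h47 h67 a b = 0 := by
  revert b
  revert a
  apply forall_fin_eight <;> apply forall_fin_eight <;> intro h <;>
    first
    | exact absurd h (by decide)
    | rfl

theorem reductionSupport_lt : ∀ a b : Fin 8, b < a → a ≠ b ∧ (a, b) ∉ reductionSupport := by
  decide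

/-- The rows and columns of a block have different index types, of equal size; the inverse is
therefore taken after identifying both with `Fin r`. -/
theorem exists_inverse {s t r : ℕ} (hs : s = r) (ht : t = r) (M : Matrix (Fin s) (Fin t) ℝ)
    (hM : Matrix.det (n := Fin r) (M.submatrix (Fin.cast hs.symm) (Fin.cast ht.symm)) ≠ 0) :
    ∃ N : Matrix (Fin t) (Fin s) ℝ, M * N = 1 ∧ N * M = 1 := by
  subst hs ht
  exact ⟨M⁻¹, Matrix.mul_nonsing_inv M (isUnit_iff_ne_zero.2 hM),
    Matrix.nonsing_inv_mul M (isUnit_iff_ne_zero.2 hM)⟩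

/-- The blocks of `H` are found by solving `H g = N H` place by place, `N` being the normal form.
Each is determined by dividing by one of the invertible blocks `C₂₃`, `C₄₅`, `C₆₇`; the remaining
places are the equations from `S`. -/
theorem exists_conj_normalForm {γ₁ γ₂ : ℝ} {g : UT (matSize m k)}
    (hg : g ∈ zeroSet m k (idealI' m k γ₁ γ₂)) :
    ∃ h P Q R D, g = h * normalForm (blk 1 2 g.1) (blk 5 6 g.1) P Q R (blk 3 4 g.1) D * h⁻¹ := by
  have hΔ : ∀ a b, (minorMatrix a b g.1).det ≠ 0 := by
    obtain ⟨hd, -⟩ := hg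
    exact evalLoc_Delta_ne_zero g hd
  rw [mem_zeroSet_iff] at hg
  obtain ⟨⟨hA, hB, hC⟩, hS0, hS1, hS2, hS2', -⟩ := hg
  obtain ⟨ai, ha, ha'⟩ : ∃ N : Block m k 2 1, blk 1 2 g.1 * N = (1 : Block m k 1 1) ∧
      N * blk 1 2 g.1 = (1 : Block m k 2 2) := exists_inverse (r := 1) rfl rfl (blk 1 2 g.1)
    (by rw [Matrix.det_unique]; exact hA)
  obtain ⟨ci, hc, hc'⟩ : ∃ N : Block m k 6 5, blk 5 6 g.1 * N = (1 : Block m k 5 5) ∧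
      N * blk 5 6 g.1 = (1 : Block m k 6 6) := exists_inverse (r := 1) rfl rfl (blk 5 6 g.1)
    (by rw [Matrix.det_unique]; exact hC)
  obtain ⟨bi, hb, hb'⟩ : ∃ N : Block m k 4 3, blk 3 4 g.1 * N = (1 : Block m k 3 3) ∧
      N * blk 3 4 g.1 = (1 : Block m k 4 4) := exists_inverse (r := k) rfl rfl (blk 3 4 g.1) hB
  have g01 : blk 0 1 g.1 = 0 :=
    schur_eq_zero_of_empty (by decide) (hΔ _ _) (hS1 (0, 1) (by decide))
  have g23 : blk 2 3 g.1 = 0 :=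
    schur_eq_zero_of_empty (by decide) (hΔ _ _) (hS1 (2, 3) (by decide))
  have g45 : blk 4 5 g.1 = 0 :=
    schur_eq_zero_of_empty (by decide) (hΔ _ _) (hS1 (4, 5) (by decide))
  have g67 : blk 6 7 g.1 = 0 :=
    schur_eq_zero_of_empty (by decide) (hΔ _ _) (hS1 (6, 7) (by decide))
  -- The blocks in row 1 of `H` and the one at (2,4) are coefficients of row operations clearing
  -- columns 3, 5 and 7 of row 1 and column 5 of row 2.
  obtain ⟨h01, e01⟩ : ∃ h01 : Block m k 0 1, blk 0 2 g.1 + h01 * blk 1 2 g.1 = 0 :=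
    ⟨-(blk 0 2 g.1 * ai), by
      rw [Matrix.neg_mul, Matrix.mul_assoc, ha', Matrix.mul_one, add_neg_cancel]⟩
  obtain ⟨h13, e13⟩ : ∃ h13 : Block m k 1 3, blk 1 4 g.1 + h13 * blk 3 4 g.1 = 0 :=
    ⟨-(blk 1 4 g.1 * bi), by
      rw [Matrix.neg_mul, Matrix.mul_assoc, hb', Matrix.mul_one, add_neg_cancel]⟩
  obtain ⟨h03, e03⟩ : ∃ h03 : Block m k 0 3, blk 0 4 g.1 + h01 * blk 1 4 g.1 + h03 * blk 3 4 g.1 = 0 :=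
    ⟨-((blk 0 4 g.1 + h01 * blk 1 4 g.1) * bi), by
      rw [Matrix.neg_mul, Matrix.mul_assoc _ bi, hb', Matrix.mul_one, add_neg_cancel]⟩
  obtain ⟨h05, e05⟩ : ∃ h05 : Block m k 0 5, blk 0 6 g.1 + h01 * blk 1 6 g.1 + h03 * blk 3 6 g.1 +
      h05 * blk 5 6 g.1 = 0 :=
    ⟨-((blk 0 6 g.1 + h01 * blk 1 6 g.1 + h03 * blk 3 6 g.1) * ci), by
      rw [Matrix.neg_mul, Matrix.mul_assoc _ ci, hc', Matrix.mul_one, add_neg_cancel]⟩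
  obtain ⟨h23, e23⟩ : ∃ h23 : Block m k 2 3, blk 1 2 g.1 * h23 = blk 1 3 g.1 :=
    ⟨ai * blk 1 3 g.1, by rw [← Matrix.mul_assoc, ha, Matrix.one_mul]⟩
  obtain ⟨h45, e45⟩ : ∃ h45 : Block m k 4 5, blk 3 4 g.1 * h45 = blk 3 5 g.1 :=
    ⟨bi * blk 3 5 g.1, by rw [← Matrix.mul_assoc, hb, Matrix.one_mul]⟩
  obtain ⟨h46, e46⟩ : ∃ h46 : Block m k 4 6, blk 3 4 g.1 * h46 = blk 3 6 g.1 :=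
    ⟨bi * blk 3 6 g.1, by rw [← Matrix.mul_assoc, hb, Matrix.one_mul]⟩
  obtain ⟨h47, e47⟩ : ∃ h47 : Block m k 4 7, blk 3 4 g.1 * h47 = blk 3 7 g.1 :=
    ⟨bi * blk 3 7 g.1, by rw [← Matrix.mul_assoc, hb, Matrix.one_mul]⟩
  obtain ⟨h67, e67⟩ : ∃ h67 : Block m k 6 7, blk 5 6 g.1 * h67 = blk 5 7 g.1 :=
    ⟨ci * blk 5 7 g.1, by rw [← Matrix.mul_assoc, hc, Matrix.one_mul]⟩
  -- Chosen so that place (2,8) of `H g = N H` holds; the subtracted product is the contribution of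
  -- the block (2,7) of `N`.
  obtain ⟨h27, e27⟩ : ∃ h27 : Block m k 2 7, blk 1 2 g.1 * h27 = blk 1 7 g.1 + h13 * blk 3 7 g.1 -
      (blk 1 6 g.1 + h13 * blk 3 6 g.1) * h67 :=
    ⟨ai * (blk 1 7 g.1 + h13 * blk 3 7 g.1 - (blk 1 6 g.1 + h13 * blk 3 6 g.1) * h67), by
      rw [← Matrix.mul_assoc, ha, Matrix.one_mul]⟩
  -- The coefficient at (3,4) was fixed by place (2,4). It must also clear `C₃₅`, which is what the
  -- first matrix equation of `S₂` says; the second one does the same for the coefficient at (5,6)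
  -- and `C₅₇`.
  have e24 : blk 2 4 g.1 + h23 * blk 3 4 g.1 = 0 := by
    rw [← e23, Matrix.mul_assoc, ← Matrix.mul_add] at hS2
    simpa [← Matrix.mul_assoc, ha'] using congrArg (ai * ·) hS2
  have e46' : blk 4 6 g.1 + h45 * blk 5 6 g.1 = 0 := by
    rw [← e45, Matrix.mul_assoc, ← Matrix.mul_add] at hS2'
    simpa [← Matrix.mul_assoc, hb'] using congrArg (bi * ·) hS2'
  have f03 : blk 0 3 g.1 + h01 * blk 1 3 g.1 = 0 :=
    schur_eq_zero_of_singleton 1 2 (by decide) h01 e01 (hΔ _ _) (hS1 (0, 3) (by decide))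
  have f25 : blk 2 5 g.1 + h23 * blk 3 5 g.1 = 0 :=
    schur_eq_zero_of_singleton 3 4 (by decide) h23 e24 (hΔ _ _) (hS1 (2, 5) (by decide))
  have f47 : blk 4 7 g.1 + h45 * blk 5 7 g.1 = 0 :=
    schur_eq_zero_of_singleton 5 6 (by decide) h45 e46' (hΔ _ _) (hS1 (4, 7) (by decide))
  have f05 : blk 0 5 g.1 + (h01 * blk 1 5 g.1 + h03 * blk 3 5 g.1) = 0 :=
    schur_eq_zero_of_pair 1 2 3 4 (by decide) (by decide) h01 h03
      (by rw [blk_lower g (show (2 : Fin 8) < 3 by decide), Matrix.mul_zero, add_zero, e01])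
      (by rw [← add_assoc, e03]) (hΔ _ _) (hS1 (0, 5) (by decide))
  -- Clearing column 7 of row 3 needs a multiple of row 6 that is not a block of `H`. It is
  -- eliminated below by `e67`, which turns its contribution into the block (3,7) of `N` times
  -- `h67`.
  have f27 : blk 2 7 g.1 + (h23 * blk 3 7 g.1 +
      (-((blk 2 6 g.1 + h23 * blk 3 6 g.1) * ci)) * blk 5 7 g.1) = 0 :=
    schur_eq_zero_of_pair 3 4 5 6 (by decide) (by decide) h23 _
      (by rw [blk_lower g (show (4 : Fin 8) < 5 by decide), Matrix.mul_zero, add_zero, e24])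
      (by rw [← add_assoc, Matrix.neg_mul, Matrix.mul_assoc _ ci, hc', Matrix.mul_one,
        add_neg_cancel]) (hΔ _ _) (hS1 (2, 7) (by decide))
  rw [← e67, Matrix.neg_mul, Matrix.mul_assoc _ ci, ← Matrix.mul_assoc ci, hc', Matrix.one_mul]
    at f27
  have f27' : blk 2 7 g.1 + h23 * blk 3 7 g.1 = (blk 2 6 g.1 + h23 * blk 3 6 g.1) * h67 := by
    rw [← sub_eq_zero, ← f27]
    abel
  have g00 := hS0 0 (by decide)
  have g33 := hS0 3 (by decide)
  have g44 := hS0 4 (by decide)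
  have g77 := hS0 7 (by decide)
  let H : UT (matSize m k) :=
    ⟨ofBlocks m k (reductionBlocks h01 h03 h05 h13 h23 h27 h45 h46 h47 h67), mem_UT_of_blk
      (fun a => by rw [blk_ofBlocks, reductionBlocks_self]; exact one_mem _)
      (fun a b h => by
        rw [blk_ofBlocks, reductionBlocks_eq_zero _ _ _ _ _ _ _ _ _ _ _ _
          (reductionSupport_lt a b h)])⟩
  have hH : ∀ a b, blk a b H.1 = reductionBlocks h01 h03 h05 h13 h23 h27 h45 h46 h47 h67 a b :=
    fun a b => blk_ofBlocks a b _
  have key : H * g = normalForm (blk 1 2 g.1) (blk 5 6 g.1)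
      (blk 1 5 g.1 + h13 * blk 3 5 g.1) (blk 1 6 g.1 + h13 * blk 3 6 g.1)
      (blk 2 6 g.1 + h23 * blk 3 6 g.1) (blk 3 4 g.1)
      (blk 0 7 g.1 + h01 * blk 1 7 g.1 + h03 * blk 3 7 g.1 + h05 * blk 5 7 g.1) * H := by
    refine Subtype.ext (blk_ext fun a b => ?_)
    rcases lt_or_ge b a with hab | hab
    · rw [blk_lower _ hab, blk_lower _ hab]
    simp only [Submonoid.coe_mul, blk_mul, Fin.sum_univ_eight, hH, blk_normalForm]
    revert hab
    revert b
    revert a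
    apply forall_fin_eight <;> apply forall_fin_eight <;> intro hab <;>
    first
    | exact absurd hab (by decide)
    | skip
    all_goals
      simp (disch := decide) only [normalBlocks_eq_zero, normalBlocks_self,
        reductionBlocks_eq_zero, reductionBlocks_self, blk_lower, blk_unit_size, g00, g33, g44,
        g77, g01, g23, g45, g67, Matrix.mul_zero, Matrix.zero_mul, Matrix.mul_one, Matrix.one_mul,
        add_zero, zero_add]
    exacts [e01, add_eq_right.2 f03, e03, add_eq_right.2 ((add_assoc _ _ _).trans f05), e05, rfl,
      rfl, (add_comm _ _).trans (congrArg (h13 + ·) e23.symm), e13, rfl, rfl,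
      (eq_sub_iff_add_eq.1 e27).symm, e24, f25, rfl,
      (congrArg (· + h27) f27').trans (add_comm _ _), rfl, e45.symm, e46.symm, e47.symm,
      add_eq_right.2 e46', add_eq_right.2 f47, rfl, e67.symm]
  exact ⟨H⁻¹, _, _, _, _, by rw [inv_inv, mul_assoc, ← key, inv_mul_cancel_left]⟩

end Reduction

/-! ### Conjugates of the normal form -/

section Conjugates

variable {m k : ℕ}

/-- Upper triangular factors only move entries upwards and to the right, so the block at `(a, b)` of
the product depends only on the blocks of `M` at or below `a` and at or to the left of `b`. -/
theorem blk_conj_of_isolated (h h' : UT (matSize m k))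
    {M : Matrix (Fin (matSize m k)) (Fin (matSize m k)) ℝ} {a b : Fin 8}
    (hM : ∀ c d, a ≤ c → d ≤ b → (c, d) ≠ (a, b) → blk c d M = 0) :
    blk a b (h.1 * M * h'.1) = blk a a h.1 * blk a b M * blk b b h'.1 := by
  rw [blk_mul, Finset.sum_eq_single b]
  · rw [blk_mul, Finset.sum_eq_single a]
    · intro c _ hc
      rcases lt_or_ge c a with hca | hca
      · rw [blk_lower h hca, Matrix.zero_mul]
      · rw [hM c b hca le_rfl fun h => hc (congrArg Prod.fst h), Matrix.mul_zero]
    · simp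
  · intro d _ hd
    rcases lt_or_ge b d with hbd | hbd
    · rw [blk_lower h' hbd, Matrix.mul_zero]
    · rw [blk_mul, Finset.sum_eq_zero, Matrix.zero_mul]
      intro c _
      rcases lt_or_ge c a with hca | hca
      · rw [blk_lower h hca, Matrix.zero_mul]
      · rw [hM c d hca hbd fun h => hd (congrArg Prod.snd h), Matrix.mul_zero]
  · simp

theorem blk_conj_eq_zero (h h' : UT (matSize m k))
    {M : Matrix (Fin (matSize m k)) (Fin (matSize m k)) ℝ} {a b : Fin 8}
    (hM : ∀ c d, a ≤ c → d ≤ b → blk c d M = 0) : blk a b (h.1 * M * h'.1) = 0 := by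
  rw [blk_conj_of_isolated h h' fun c d hc hd _ => hM c d hc hd, hM a b le_rfl le_rfl,
    Matrix.mul_zero, Matrix.zero_mul]

/-- The product factors through a space of dimension one less than its size, so its rank is too
small. -/
theorem det_mul_eq_zero_of_option {ι : Type*} [Fintype ι] [DecidableEq ι]
    (L : Matrix (Option ι) ι ℝ) (K : Matrix ι (Option ι) ℝ) : (L * K).det = 0 := by
  by_contra hdet
  have h1 := Matrix.rank_of_isUnit (L * K)
    ((Matrix.isUnit_iff_isUnit_det _).2 (isUnit_iff_ne_zero.2 hdet))
  have h2 := (Matrix.rank_mul_le_left L K).trans (Matrix.rank_le_card_width L)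
  rw [h1, Fintype.card_option] at h2
  omega

/-- If only the summation indices in the image of `e` contribute, the submatrix is a product through
`ι`, one index fewer than `Option ι`. -/
theorem det_submatrix_mul_eq_zero {n ι : Type*} [Fintype n] [Fintype ι] [DecidableEq ι]
    (r c : Option ι → n) (Y Z : Matrix n n ℝ) {e : ι → n} (he : Function.Injective e)
    (h : ∀ u, u ∉ Set.range e → ∀ x y, Y (r x) u * Z u (c y) = 0) :
    ((Y * Z).submatrix r c).det = 0 := by
  have : (Y * Z).submatrix r c = Y.submatrix r e * Z.submatrix e c := by
    ext x y
    rw [Matrix.submatrix_apply, Matrix.mul_apply, Matrix.mul_apply]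
    symm
    refine Finset.sum_of_injOn e he.injOn (fun _ _ => Finset.mem_coe.2 (Finset.mem_univ _))
      (fun u _ hu => h u (fun ⟨i, hi⟩ => hu ⟨i, Finset.mem_coe.2 (Finset.mem_univ i), hi⟩) x y)
      fun _ _ => rfl
  rw [this]
  exact det_mul_eq_zero_of_option _ _

theorem minorRow_injective (a b : Fin 8) : Function.Injective (minorRow m k a b) := by
  have hΦ : ∀ p ∈ Phi, ∀ q ∈ Phi, p.1 = q.1 → p = q := by decide
  rintro ⟨⟨p, hp, hp'⟩, i⟩ ⟨⟨q, hq, hq'⟩, j⟩ h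
  have h' := (pos_sigma_bijective m k).1 (a₁ := ⟨p.1, i⟩) (a₂ := ⟨q.1, j⟩) h
  obtain rfl := hΦ p hp q hq (congrArg Sigma.fst h')
  obtain rfl : i = j := pos_inj.1 h
  rfl

theorem minorCol_injective (a b : Fin 8) : Function.Injective (minorCol m k a b) := by
  have hΦ : ∀ p ∈ Phi, ∀ q ∈ Phi, p.2 = q.2 → p = q := by decide
  rintro ⟨⟨p, hp, hp'⟩, i⟩ ⟨⟨q, hq, hq'⟩, j⟩ h
  have h' := (pos_sigma_bijective m k).1 (a₁ := ⟨p.2, _⟩) (a₂ := ⟨q.2, _⟩) h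
  obtain rfl := hΦ p hp q hq (congrArg Sigma.fst h')
  obtain rfl : i = j := Fin.cast_injective _ (pos_inj.1 h)
  rfl

theorem mem_range_minorRow {a b : Fin 8} {q : Fin 8 × Fin 8} (hq : q ∈ Phi) (ha : a < q.1)
    (hb : q.2 < b) (i : Fin (blockSize m k q.1)) :
    pos m k q.1 i ∈ Set.range (minorRow m k a b) :=
  ⟨⟨⟨q, hq, ha, hb⟩, i⟩, rfl⟩

theorem mem_range_minorCol {a b : Fin 8} {q : Fin 8 × Fin 8} (hq : q ∈ Phi) (ha : a < q.1)
    (hb : q.2 < b) (j : Fin (blockSize m k q.2)) :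
    pos m k q.2 j ∈ Set.range (minorCol m k a b) :=
  ⟨⟨⟨q, hq, ha, hb⟩, Fin.cast (blockSize_of_mem_Phi m k hq).symm j⟩, rfl⟩

theorem exists_borderedRow (a b : Fin 8) (i : Fin (blockSize m k a))
    (x : Option (MinorIndex m k a b)) :
    ∃ c j, x.elim (pos m k a i) (minorRow m k a b) = pos m k c j ∧
      (c = a ∨ ∃ q ∈ Phi, a < q.1 ∧ q.2 < b ∧ c = q.1) := by
  rcases x with _ | ⟨⟨q, hq, hq'⟩, j⟩
  · exact ⟨a, i, rfl, Or.inl rfl⟩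
  · exact ⟨q.1, j, rfl, Or.inr ⟨q, hq, hq'.1, hq'.2, rfl⟩⟩

theorem exists_borderedCol (a b : Fin 8) (j : Fin (blockSize m k b))
    (x : Option (MinorIndex m k a b)) :
    ∃ d i, x.elim (pos m k b j) (minorCol m k a b) = pos m k d i ∧
      (d = b ∨ ∃ q ∈ Phi, a < q.1 ∧ q.2 < b ∧ d = q.2) := by
  rcases x with _ | ⟨⟨q, hq, hq'⟩, i⟩
  · exact ⟨b, j, rfl, Or.inl rfl⟩
  · exact ⟨q.2, _, rfl, Or.inr ⟨q, hq, hq'.1, hq'.2, rfl⟩⟩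

/-- A bordered minor of a conjugate vanishes if, in the rows of the blocks from `a` on and the
columns of the blocks up to `b`, the nonzero blocks lie in the rows of the minor `Δ`, or if they
lie in its columns. -/
theorem det_bordered_conj_eq_zero (h h' : UT (matSize m k))
    {M : Matrix (Fin (matSize m k)) (Fin (matSize m k)) ℝ} {T : Finset (Fin 8 × Fin 8)}
    (hM : ∀ c d, (c, d) ∉ T → blk c d M = 0) {a b : Fin 8}
    (hT : (∀ x ∈ T, a ≤ x.1 → x.2 ≤ b → ∃ q ∈ Phi, a < q.1 ∧ q.2 < b ∧ q.1 = x.1) ∨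
      (∀ x ∈ T, a ≤ x.1 → x.2 ≤ b → ∃ q ∈ Phi, a < q.1 ∧ q.2 < b ∧ q.2 = x.2))
    (i : Fin (blockSize m k a)) (j : Fin (blockSize m k b)) :
    (borderedMatrix a b i j (h.1 * M * h'.1)).det = 0 := by
  have hrow : ∀ (x : Option (MinorIndex m k a b)) (c : Fin 8) (l : Fin (blockSize m k c)), c < a →
      h.1 (x.elim (pos m k a i) (minorRow m k a b)) (pos m k c l) = 0 := fun x c l hc => by
    obtain ⟨e, s, hs, he⟩ := exists_borderedRow a b i x
    rw [hs]
    refine h.2.2 _ _ (pos_lt_pos ?_ _ _)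
    rcases he with rfl | ⟨q, hq, h1, h2, rfl⟩
    · exact hc
    · exact hc.trans h1
  have hcol : ∀ (x : Option (MinorIndex m k a b)) (d : Fin 8) (l : Fin (blockSize m k d)), b < d →
      h'.1 (pos m k d l) (x.elim (pos m k b j) (minorCol m k a b)) = 0 := fun x c l hc => by
    obtain ⟨e, s, hs, he⟩ := exists_borderedCol a b j x
    rw [hs]
    refine h'.2.2 _ _ (pos_lt_pos ?_ _ _)
    rcases he with rfl | ⟨q, hq, h1, h2, rfl⟩
    · exact hc
    · exact h2.trans hc
  -- When the nonzero blocks lie in the rows of `Δ`, the product is split as `h (M h')` and summed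
  -- over those rows; when they lie in its columns, it is split as `(h M) h'`.
  rcases hT with hT | hT
  · rw [Matrix.mul_assoc]
    refine det_submatrix_mul_eq_zero _ _ _ _ (minorRow_injective a b) fun u hu x y => ?_
    obtain ⟨c, s, rfl⟩ := exists_pos u
    rcases lt_or_ge c a with hc | hc
    · rw [hrow x c s hc, zero_mul]
    · rw [Matrix.mul_apply, Finset.sum_eq_zero, mul_zero]
      intro v _
      obtain ⟨d, t, rfl⟩ := exists_pos v
      rcases lt_or_ge b d with hd | hd
      · rw [hcol y d t hd, mul_zero]
      · have : blk c d M = 0 := hM c d fun hcd => by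
          obtain ⟨q, h1, h2, h3, rfl⟩ := hT (c, d) hcd hc hd
          exact hu (mem_range_minorRow h1 h2 h3 s)
        rw [show M (pos m k c s) (pos m k d t) = 0 from congrFun (congrFun this s) t, zero_mul]
  · refine det_submatrix_mul_eq_zero _ _ _ _ (minorCol_injective a b) fun v hv x y => ?_
    obtain ⟨d, t, rfl⟩ := exists_pos v
    rcases lt_or_ge b d with hd | hd
    · rw [hcol y d t hd, mul_zero]
    · rw [Matrix.mul_apply, Finset.sum_eq_zero, zero_mul]
      intro u _
      obtain ⟨c, s, rfl⟩ := exists_pos u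
      rcases lt_or_ge c a with hc | hc
      · rw [hrow x c s hc, zero_mul]
      · have : blk c d M = 0 := hM c d fun hcd => by
          obtain ⟨q, h1, h2, h3, rfl⟩ := hT (c, d) hcd hc hd
          exact hv (mem_range_minorCol h1 h2 h3 t)
        rw [show M (pos m k c s) (pos m k d t) = 0 from congrFun (congrFun this s) t, mul_zero]

/-- No block occurs among both the rows and the columns of such a minor, so the identity matrix
contributes nothing. -/
theorem borderedMatrix_add_one {a b : Fin 8} (hab : (a, b) ∈ bulletBlocks)
    (i : Fin (blockSize m k a)) (j : Fin (blockSize m k b))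
    (P : Matrix (Fin (matSize m k)) (Fin (matSize m k)) ℝ) :
    borderedMatrix a b i j (1 + P) = borderedMatrix a b i j P := by
  have hne : ∀ r ∈ bulletBlocks, r.1 ≠ r.2 := by decide
  have hlt : ∀ q ∈ Phi, q.1 < q.2 := by decide
  have hne' : ∀ p ∈ Phi, ∀ q ∈ Phi, p.1 ≠ q.2 := by decide
  ext x y
  obtain ⟨c, s, hs, hc⟩ := exists_borderedRow a b i x
  obtain ⟨d, t, ht, hd⟩ := exists_borderedCol a b j y
  simp only [borderedMatrix, Matrix.submatrix_apply, hs, ht, Matrix.add_apply]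
  rw [Matrix.one_apply_ne (pos_ne ?_ s t), zero_add]
  rcases hc with rfl | ⟨p, hp, hp1, hp2, rfl⟩ <;>
    rcases hd with rfl | ⟨q, hq, hq1, hq2, rfl⟩
  · exact hne _ hab
  · exact (hq1.trans (hlt q hq)).ne
  · exact ((hlt p hp).trans hp2).ne
  · exact hne' p hp q hq

theorem det_conj_ne_zero {s : ℕ} {U V : Matrix (Fin s) (Fin s) ℝ} (hU : U ∈ UT s) (hV : V ∈ UT s)
    {B : Matrix (Fin s) (Fin s) ℝ} (hB : B.det ≠ 0) : (U * B * V).det ≠ 0 := by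
  rw [Matrix.det_mul, Matrix.det_mul, UT.det_eq_one ⟨U, hU⟩, UT.det_eq_one ⟨V, hV⟩]
  simpa using hB

theorem conj_normalForm_mem_zeroSet {γ₁ γ₂ : ℝ} (h : UT (matSize m k))
    {A : Block m k 1 2} {C : Block m k 5 6} {P : Block m k 1 5} {Q : Block m k 1 6}
    {R : Block m k 2 6} {B : Block m k 3 4} {D : Block m k 0 7}
    (hA : entry rfl rfl A ≠ 0) (hC : entry rfl rfl C ≠ 0) (hB : Matrix.det (n := Fin k) B ≠ 0)
    (hAC : γ₁ * entry rfl rfl A - γ₂ * entry rfl rfl C = 0) :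
    h * normalForm A C P Q R B D * h⁻¹ ∈ zeroSet m k (idealI' m k γ₁ γ₂) := by
  obtain ⟨M, hM⟩ : ∃ M, (normalForm A C P Q R B D).1 = 1 + M := ⟨_, (add_sub_cancel _ _).symm⟩
  have hMblk : ∀ a b, blk a b M = normalBlocks A C P Q R B D a b - blk a b 1 := fun a b => by
    rw [← blk_normalForm, hM, blk_add, add_sub_cancel_left]
  have hM0 : ∀ a b, (a, b) ∉ normalSupport → blk a b M = 0 := fun a b hab => by
    rw [hMblk]
    by_cases h' : a = b
    · subst h'
      rw [normalBlocks_self, blk_one_self, sub_self]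
    · rw [normalBlocks_eq_zero _ _ _ _ _ _ _ _ _ ⟨h', hab⟩, blk_one_ne h', sub_zero]
  have hx : (h * normalForm A C P Q R B D * h⁻¹).1 = 1 + h.1 * M * (h⁻¹).1 := by
    rw [Submonoid.coe_mul, Submonoid.coe_mul, hM, Matrix.mul_add, Matrix.add_mul, Matrix.mul_one,
      UT.coe_mul_coe_inv]
  have hA' : blk 1 2 (h.1 * M * (h⁻¹).1) = A := by
    rw [blk_conj_of_isolated, blk_unit_size h (by decide), blk_unit_size h⁻¹ (by decide),
      Matrix.one_mul, Matrix.mul_one, hMblk, blk_one_ne (by decide), sub_zero]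
    · rfl
    · exact fun c d h1 h2 h3 => hM0 c d (by revert c d; decide)
  have hC' : blk 5 6 (h.1 * M * (h⁻¹).1) = C := by
    rw [blk_conj_of_isolated, blk_unit_size h (by decide), blk_unit_size h⁻¹ (by decide),
      Matrix.one_mul, Matrix.mul_one, hMblk, blk_one_ne (by decide), sub_zero]
    · rfl
    · exact fun c d h1 h2 h3 => hM0 c d (by revert c d; decide)
  have hB' : blk 3 4 (h.1 * M * (h⁻¹).1) = blk 3 3 h.1 * B * blk 4 4 (h⁻¹).1 := by
    rw [blk_conj_of_isolated, hMblk, blk_one_ne (by decide), sub_zero]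
    · rfl
    · exact fun c d h1 h2 h3 => hM0 c d (by revert c d; decide)
  have hdiag : ∀ a b, b ≤ a → blk a b (h.1 * M * (h⁻¹).1) = 0 := fun a b hab =>
    blk_conj_eq_zero h h⁻¹ fun c d h1 h2 => hM0 c d (by
      have : ∀ c d : Fin 8, d ≤ c → (c, d) ∉ normalSupport := by decide
      exact this c d (h2.trans (hab.trans h1)))
  -- The square of `h M h⁻¹` is `h M² h⁻¹`, so its block at `(a, b)` vanishes once no two supported
  -- blocks of `M` compose to a place below and to the left of `(a, b)`.
  have hsq : ∀ a b, (∀ c d, a ≤ c → d ≤ b → ∀ e, (c, e) ∈ normalSupport →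
      (e, d) ∉ normalSupport) →
      ∑ c, blk a c (h.1 * M * (h⁻¹).1) * blk c b (h.1 * M * (h⁻¹).1) = 0 := fun a b hab => by
    rw [← blk_mul]
    have : h.1 * M * (h⁻¹).1 * (h.1 * M * (h⁻¹).1) = h.1 * (M * M) * (h⁻¹).1 := by
      calc _ = h.1 * M * ((h⁻¹).1 * h.1) * M * (h⁻¹).1 := by simp only [Matrix.mul_assoc]
        _ = _ := by rw [UT.coe_inv_mul_coe]; simp only [Matrix.mul_assoc, Matrix.one_mul]
    rw [this]
    refine blk_conj_eq_zero h h⁻¹ fun c d h1 h2 => ?_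
    rw [blk_mul]
    refine Finset.sum_eq_zero fun e _ => ?_
    by_cases he : (c, e) ∈ normalSupport
    · rw [hM0 e d (hab c d h1 h2 e he), Matrix.mul_zero]
    · rw [hM0 c e he, Matrix.zero_mul]
  rw [mem_zeroSet_iff, hx]
  have hoff : ∀ a b, a ≠ b →
      blk a b (1 + h.1 * M * (h⁻¹).1) = blk a b (h.1 * M * (h⁻¹).1) := fun a b hab => by
    rw [blk_add, blk_one_ne hab, zero_add]
  simp (disch := decide) only [hoff, hA', hC', hB']
  refine ⟨⟨hA, ?_, hC⟩, fun b _ => ?_, fun p hp i j => ?_, ?_, ?_, hAC⟩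
  · exact det_conj_ne_zero (blk_self_mem_UT h 3) (blk_self_mem_UT h⁻¹ 4) hB
  · rw [blk_add, hdiag b b le_rfl, blk_one_self, add_zero]
  · rw [borderedMatrix_add_one hp]
    refine det_bordered_conj_eq_zero h h⁻¹ hM0 ?_ i j
    have hrow : ∀ p ∈ bulletBlocks, p ≠ (2, 7) → ∀ x ∈ normalSupport, p.1 ≤ x.1 → x.2 ≤ p.2 →
        ∃ q ∈ Phi, p.1 < q.1 ∧ q.2 < p.2 ∧ q.1 = x.1 := by
      set_option maxRecDepth 10000 in decide
    -- The place (3,8) is exceptional: the block (3,7) of `M` is not in a row of `Δ`, but all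
    -- relevant blocks lie in its columns 5 and 7.
    by_cases hp' : p = (2, 7)
    · subst hp'
      exact Or.inr (by decide)
    · exact Or.inl (hrow p hp hp')
  -- By strict block triangularity only two terms remain in the block (2,5) of the square, and they
  -- form the required expression; the block (4,7) behaves alike.
  · have := hsq 1 4 (by decide)
    simp (disch := decide) only [Fin.sum_univ_eight, hdiag, Matrix.mul_zero, Matrix.zero_mul,
      add_zero, zero_add, hA', hB'] at this
    exact this
  · have := hsq 3 6 (by decide)
    simp (disch := decide) only [Fin.sum_univ_eight, hdiag, Matrix.mul_zero, Matrix.zero_mul,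
      add_zero, zero_add, hC', hB'] at this
    exact this

/-- The blocks of a block diagonal matrix with the blocks `U₀`, `U₃`, `U₄`, `U₇`. -/
def diagonalBlocks (U₀ : Block m k 0 0) (U₃ : Block m k 3 3) (U₄ : Block m k 4 4)
    (U₇ : Block m k 7 7) (a b : Fin 8) : Block m k a b :=
  match a, b with
  | 0, 0 => U₀
  | 1, 1 => 1
  | 2, 2 => 1
  | 3, 3 => U₃
  | 4, 4 => U₄
  | 5, 5 => 1
  | 6, 6 => 1
  | 7, 7 => U₇
  | _, _ => 0

theorem diagonalBlocks_ne (U₀ : Block m k 0 0) (U₃ : Block m k 3 3) (U₄ : Block m k 4 4)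
    (U₇ : Block m k 7 7) (a b : Fin 8) (h : a ≠ b) : diagonalBlocks U₀ U₃ U₄ U₇ a b = 0 := by
  revert b
  revert a
  apply forall_fin_eight <;> apply forall_fin_eight <;> intro h <;>
    first
    | exact absurd rfl h
    | rfl

/-- The conjugation is by `diag(U₀, 1, 1, U₃, V₄⁻¹, 1, 1, V₇⁻¹)`. It changes only `B` and `D`, since
the other blocks connect block rows and columns of size one. -/
theorem conj_normalForm_eq (U₀ : UT (blockSize m k 0)) (U₃ : UT (blockSize m k 3))
    (V₄ : UT (blockSize m k 4)) (V₇ : UT (blockSize m k 7))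
    (A : Block m k 1 2) (C : Block m k 5 6) (P : Block m k 1 5) (Q : Block m k 1 6)
    (R : Block m k 2 6) (B : Block m k 3 4) (D : Block m k 0 7) :
    ∃ h, normalForm A C P Q R (U₃.1 * B * V₄.1) (U₀.1 * D * V₇.1) =
      h * normalForm A C P Q R B D * h⁻¹ := by
  let H : UT (matSize m k) :=
    ⟨ofBlocks m k (diagonalBlocks U₀.1 U₃.1 (V₄⁻¹).1 (V₇⁻¹).1), mem_UT_of_blk
      (fun a => by
        rw [blk_ofBlocks]
        revert a
        apply forall_fin_eight
        exacts [U₀.2, one_mem _, one_mem _, U₃.2, (V₄⁻¹).2, one_mem _, one_mem _, (V₇⁻¹).2])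
      (fun a b h => by rw [blk_ofBlocks, diagonalBlocks_ne _ _ _ _ _ _ h.ne'])⟩
  have hH : ∀ a b, blk a b H.1 = diagonalBlocks U₀.1 U₃.1 (V₄⁻¹).1 (V₇⁻¹).1 a b :=
    fun a b => blk_ofBlocks a b _
  refine ⟨H, eq_mul_inv_of_mul_eq (Subtype.ext (blk_ext fun a b => ?_))⟩
  rw [Submonoid.coe_mul, Submonoid.coe_mul, blk_mul, blk_mul, Finset.sum_eq_single b,
    Finset.sum_eq_single a]
  rotate_left
  · intro c _ hc
    rw [hH, diagonalBlocks_ne _ _ _ _ _ _ hc.symm, Matrix.zero_mul]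
  · simp
  · intro c _ hc
    rw [hH, diagonalBlocks_ne _ _ _ _ _ _ hc, Matrix.mul_zero]
  · simp
  rw [hH, hH, blk_normalForm, blk_normalForm]
  by_cases hab : a = b
  · subst hab
    rw [normalBlocks_self, normalBlocks_self, Matrix.one_mul, Matrix.mul_one]
  by_cases hS : (a, b) ∈ normalSupport
  · have hV₄ : U₃.1 * B * V₄.1 * (V₄⁻¹).1 = U₃.1 * B := by
      rw [Matrix.mul_assoc, UT.coe_mul_coe_inv, Matrix.mul_one]
    have hV₇ : U₀.1 * D * V₇.1 * (V₇⁻¹).1 = U₀.1 * D := by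
      rw [Matrix.mul_assoc, UT.coe_mul_coe_inv, Matrix.mul_one]
    simp only [normalSupport, Finset.mem_insert, Finset.mem_singleton, Prod.mk.injEq] at hS
    rcases hS with h | h | h | h | h | h | h <;> obtain ⟨rfl, rfl⟩ := h
    · exact (Matrix.mul_one _).trans (Matrix.one_mul _).symm
    · exact (Matrix.mul_one _).trans (Matrix.one_mul _).symm
    · exact (Matrix.mul_one _).trans (Matrix.one_mul _).symm
    · exact (Matrix.mul_one _).trans (Matrix.one_mul _).symm
    · exact (Matrix.mul_one _).trans (Matrix.one_mul _).symm
    · exact hV₄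
    · exact hV₇
  · rw [normalBlocks_eq_zero _ _ _ _ _ _ _ _ _ ⟨hab, hS⟩,
      normalBlocks_eq_zero _ _ _ _ _ _ _ _ _ ⟨hab, hS⟩, Matrix.zero_mul, Matrix.mul_zero]

end Conjugates

/-! ### The two inclusions -/

section Closure

variable {m k : ℕ}

theorem conj_mem_conjugates {n : ℕ} {S : Set (UT n)} (h : UT n) {x : UT n} (hx : x ∈ conjugates S) :
    h * x * h⁻¹ ∈ conjugates S := by
  obtain ⟨h', y, hy, rfl⟩ := hx
  exact ⟨h * h', y, hy, by group⟩

theorem continuous_conj {n : ℕ} (h : UT n) : Continuous fun x : UT n => h * x * h⁻¹ := by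
  fun_prop

theorem zeroSet_subset_closure (l₁ : Fin m → ℝ) (l₂ : Fin k → ℝ) {γ₁ γ₂ γ₃ : ℝ} (hγ₂ : γ₂ ≠ 0) :
    zeroSet m k (idealI' m k γ₁ γ₂) ⊆
      closure (conjugates (coadjStabilizer (traceDual (fMatrix m k l₁ l₂ γ₁ γ₂ γ₃)))) := by
  intro g hg
  obtain ⟨h, P, Q, R, D, hgh⟩ := exists_conj_normalForm hg
  have hAC := ((mem_zeroSet_iff γ₁ γ₂ g).1 hg).2.2.2.2.2
  rw [hgh]
  refine map_mem_closure (f := fun x => h * x * h⁻¹) (continuous_conj h) ?_ fun x hx => conj_mem_conjugates h hx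
  have hA : blk 1 2 g.1 = Matrix.of fun _ _ => entry rfl rfl (blk 1 2 g.1) :=
    eq_const_of_size_eq_one rfl rfl _ _ _
  have hC : blk 5 6 g.1 = Matrix.of fun _ _ => γ₁ * entry rfl rfl (blk 1 2 g.1) / γ₂ := by
    have : entry rfl rfl (blk 5 6 g.1) = γ₁ * entry rfl rfl (blk 1 2 g.1) / γ₂ := by
      rw [eq_div_iff hγ₂]
      linarith
    rw [← this]
    exact eq_const_of_size_eq_one rfl rfl _ _ _
  rw [hA, hC]
  -- With the other blocks fixed, `B` and `D` are approximated simultaneously by big cell matrices,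
  -- for which the normal form is conjugate to a stabilizer element.
  refine map_mem_closure₂ (s := bigCell k) (t := bigCell m)
    (f := fun (B : Matrix (Fin k) (Fin k) ℝ) (D : Matrix (Fin m) (Fin m) ℝ) =>
      normalForm (m := m) (k := k) (Matrix.of fun _ _ => entry rfl rfl (blk 1 2 g.1))
        (Matrix.of fun _ _ => γ₁ * entry rfl rfl (blk 1 2 g.1) / γ₂) P Q R B D)
    (continuous_normalForm continuous_const continuous_const continuous_fst continuous_snd)
    (dense_bigCell k _) (dense_bigCell m _) ?_
  rintro _ ⟨U₃, V₄, b, rfl⟩ _ ⟨U₀, V₇, d, rfl⟩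
  obtain ⟨h', hh'⟩ := conj_normalForm_eq (m := m) (k := k) U₀ U₃ V₄ V₇
    (Matrix.of fun _ _ => entry rfl rfl (blk 1 2 g.1))
    (Matrix.of fun _ _ => γ₁ * entry rfl rfl (blk 1 2 g.1) / γ₂) P Q R (blockB m b) (blockD k d)
  exact ⟨h', _, stabElement_mem P Q R l₁ l₂ hγ₂ (entry rfl rfl (blk 1 2 g.1)) b d, hh'⟩

theorem conjugates_subset_closure {l₁ : Fin m → ℝ} {l₂ : Fin k → ℝ} {γ₁ γ₂ γ₃ : ℝ}
    (hl₁ : ∀ j, l₁ j ≠ 0) (hl₂ : ∀ j : Fin k, (j : ℕ) + 1 < k → l₂ j ≠ 0)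
    (hγ₁ : γ₁ ≠ 0) (hγ₂ : γ₂ ≠ 0) :
    conjugates (coadjStabilizer (traceDual (fMatrix m k l₁ l₂ γ₁ γ₂ γ₃))) ⊆
      closure (zeroSet m k (idealI' m k γ₁ γ₂)) := by
  rintro _ ⟨h, y, hy, rfl⟩
  obtain ⟨P, Q, R, α, b, d, rfl⟩ := eq_stabElement hl₁ hl₂ hγ₁ hγ₂ hy
  have hb : b ∈ closure (Set.pi Set.univ fun _ : Fin k => ({0}ᶜ : Set ℝ)) :=
    dense_pi Set.univ (fun _ _ => dense_compl_singleton 0) b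
  have hconst : Continuous fun (α : ℝ) => (Matrix.of fun _ _ => α : Block m k 1 2) :=
    continuous_matrix fun _ _ => continuous_id
  have hconst' : Continuous fun (α : ℝ) => (Matrix.of fun _ _ => γ₁ * α / γ₂ : Block m k 5 6) :=
    continuous_matrix fun _ _ => (continuous_const.mul continuous_id).div_const _
  have hcont : Continuous (Function.uncurry fun (α : ℝ) (b : Fin k → ℝ) =>
      stabElement P Q R γ₁ γ₂ α b d) :=
    continuous_normalForm (hconst.comp continuous_fst) (hconst'.comp continuous_fst)
      (continuous_antidiag.comp continuous_snd) continuous_const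
  -- Only `α` and `b` are perturbed: `d` contains just `C₂₃`, `C₄₅` and `C₆₇`, so the block at (1,8)
  -- may stay singular.
  refine map_mem_closure₂ (f := fun (α : ℝ) (b : Fin k → ℝ) =>
    h * stabElement P Q R γ₁ γ₂ α b d * h⁻¹) ((continuous_conj h).comp hcont)
    (dense_compl_singleton (0 : ℝ) α) hb fun α' hα b' hb' => ?_
  refine conj_normalForm_mem_zeroSet h hα ?_ (det_antidiag_ne_zero fun j => hb' j trivial) ?_
  · exact div_ne_zero (mul_ne_zero hγ₁ hα) hγ₂
  · change γ₁ * α' - γ₂ * (γ₁ * α' / γ₂) = 0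
    rw [mul_div_cancel₀ _ hγ₂, sub_self]

end Closure

/-- `UT (matSize m k)` carries the topology of real matrices (subspace topology). -/
theorem proposition5 (m k : ℕ) (l₁ : Fin m → ℝ) (l₂ : Fin k → ℝ) (γ₁ γ₂ γ₃ : ℝ)
    (hl₁ : ∀ j, l₁ j ≠ 0) (hl₂ : ∀ j : Fin k, (j : ℕ) + 1 < k → l₂ j ≠ 0)
    (hγ₁ : γ₁ ≠ 0) (hγ₂ : γ₂ ≠ 0) :
    closure (zeroSet m k (idealI' m k γ₁ γ₂)) =
      closure (conjugates (coadjStabilizer (traceDual (fMatrix m k l₁ l₂ γ₁ γ₂ γ₃)))) :=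
  Set.Subset.antisymm (closure_minimal (zeroSet_subset_closure l₁ l₂ hγ₂) isClosed_closure)
    (closure_minimal (conjugates_subset_closure hl₁ hl₂ hγ₁ hγ₂) isClosed_closure)
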